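/- Let $\Omega$ be a finite set and let $P$ be a row-stochastic matrix on $\Omega$ with stationary distribution $\pi(P)$. Let $\|E\|_\infty=\max_x\sum_y|E_{xy}|$, let $$\tau_1(P)=\sup\{\|v^TP\|_1 : v\in\mathbb R^\Omega,\ \|v\|_1=1,\ v^Te=0\},\qquad e=(1,\dots,1)^T,$$ be the ergodicity coefficient of $P$ (the supremum over the empty set being $0$), and let $D(p,q)=\frac12\sum_{x}|p_x-q_x|$ be the total variation distance. Assume $\tau_1(P)<1$. Let $Q=P+E$ be a perturbed chain, and let $Q_0,Q_1,\dots,Q_r=Q$ be ergodic (irreducible and aperiodic) reversible Markov chains on $\Omega$ with stationary distributions $\pi_0,\dots,\pi_r=\pi(Q)$, such that for some $c>0$ the coherent states $|\pi_i\rangle=\sum_x\sqrt{\pi_i(x)}\,|x\rangle$ satisfy $|\langle\pi_i|\pi_{i+1}\rangle|^2\ge c$ for $0\le i<r$. Let $\tilde\pi(Q)$ denote the distribution obtained by preparing a coherent quantum sample of $Q$ by the Wocjan–Abeyesinghe method and measuring it in the computational basis. The method starts from $|\pi_0\rangle$ and, for $i=0,\dots,r-1$, applies the $m$-th level of Grover's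 $\frac\pi3$-amplitude amplification, $V_0=1$, $V_{j+1}=V_jR_iV_j^\dagger R_{i+1}V_j$, where $R_i$ is the approximate selective phase shift by $e^{i\pi/3}$ of $|\pi_i\rangle$, implemented by $k$ phase estimations, with $t$ qubits each, of Szegedy's quantum walk of $Q_i$. Its parameters are $t,k,m\in\mathbb N$. Then for every $\eta>0$: 1. the parameters can be chosen such that the sample is prepared with precision $\eta$, that is, $D(\tilde\pi(Q),\pi(Q))\le\eta$; 2. whenever the sample is prepared with precision $\eta$, $$D(\tilde\pi(Q),\pi(P))\le\eta+\frac{\|E\|_\infty}{2(1-\tau_1(P))}.$$ -/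

import Mathlib

open scoped Matrix Kronecker

noncomputable section

namespace QSample

/-! ### Classical Markov chains

Transition matrices are row-stochastic (`Matrix.rowStochastic`), distributions are points of
`stdSimplex ℝ Ω`, acted on from the right.  For symmetric matrices this coincides with the
column convention `P π = π`. -/

section Classical

variable {Ω : Type*} [Fintype Ω]

/-- `p` is a stationary distribution of `P`. -/
def IsStationary (P : Matrix Ω Ω ℝ) (p : Ω → ℝ) : Prop :=
  p ∈ stdSimplex ℝ Ω ∧ p ᵥ* P = p

/-- Detailed balance. -/
def IsReversible (P : Matrix Ω Ω ℝ) (p : Ω → ℝ) : Prop :=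
  ∀ x y, p x * P x y = p y * P y x

/-- Total variation distance. -/
def tv (p q : Ω → ℝ) : ℝ := (1 / 2) * ∑ x, |p x - q x|

/-- The ergodicity coefficient for the `l₁` norm,
`τ₁(P) = sup {‖vᵀ P‖₁ : ‖v‖₁ = 1, vᵀ e = 0}`. -/
def tau₁ (P : Matrix Ω Ω ℝ) : ℝ :=
  sSup {s | ∃ v : Ω → ℝ, ∑ x, |v x| = 1 ∧ ∑ x, v x = 0 ∧ s = ∑ y, |(v ᵥ* P) y|}

/-- The matrix norm `‖E‖_∞`: the maximal absolute row sum. -/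
def infNorm (E : Matrix Ω Ω ℝ) : ℝ := ⨆ x, ∑ y, |E x y|

/-- The overlap `⟨p|q⟩` of the coherent states `|p⟩ = ∑ₓ √p(x) |x⟩` and `|q⟩ = ∑ₓ √q(x) |x⟩`. -/
def overlap (p q : Ω → ℝ) : ℝ := ∑ x, √(p x) * √(q x)

end Classical

/-! ### Szegedy's quantum walk

The walk of a chain on `Ω` acts on `ℂ^Ω ⊗ ℂ^(Ω ∪ {0})`; the extra basis state `0` is `none`. -/

section Walk

variable {Ω : Type*} [Fintype Ω] [DecidableEq Ω]

/-- The index set of the computational basis of the two walk registers. -/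
abbrev Sys (Ω : Type*) := Ω × Option Ω

/-- The amplitudes of `|p_x⟩ = ∑_y √(P x y) |y⟩`. -/
def amp (P : Matrix Ω Ω ℝ) (x : Ω) : Option Ω → ℂ
  | none => 0
  | some y => (√(P x y) : ℝ)

/-- `|0⟩ - |p_x⟩`. -/
def householder (P : Matrix Ω Ω ℝ) (x : Ω) (a : Option Ω) : ℂ :=
  (if a = none then 1 else 0) - amp P x a

/-- The update unitary `U` with `U |x⟩|0⟩ = |x⟩|p_x⟩`: controlled on the first register, it is
the Householder reflection `1 - (|0⟩ - |p_x⟩)(⟨0| - ⟨p_x|)` of the second register, which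
exchanges the orthogonal unit vectors `|0⟩` and `|p_x⟩`. -/
def update (P : Matrix Ω Ω ℝ) : Matrix (Sys Ω) (Sys Ω) ℂ :=
  Matrix.of fun s s' =>
    if s.1 = s'.1 then
      (if s.2 = s'.2 then 1 else 0) - householder P s.1 s.2 * star (householder P s.1 s'.2)
    else 0

/-- `|x⟩|p_x⟩`. -/
def vecA (P : Matrix Ω Ω ℝ) (x : Ω) : Sys Ω → ℂ :=
  fun s => if s.1 = x then amp P x s.2 else 0

/-- `|p_y⟩|y⟩`. -/
def vecB (P : Matrix Ω Ω ℝ) (y : Ω) : Sys Ω → ℂ :=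
  fun s => if s.2 = some y then amp P y (some s.1) else 0

/-- The reflection `2 ∑ₓ |v x⟩⟨v x| - 1` through the span of an orthonormal family `v`. -/
def reflect (v : Ω → Sys Ω → ℂ) : Matrix (Sys Ω) (Sys Ω) ℂ :=
  (2 : ℂ) • ∑ x, Matrix.vecMulVec (v x) (star (v x)) - 1

/-- Szegedy's walk `ref_B ref_A` with `A = span {|x⟩|p_x⟩}` and `B = span {|p_y⟩|y⟩}`, in the frame
rotated by `U`, in which `|π⟩|0⟩` is the stationary state for every chain. -/
def walk (P : Matrix Ω Ω ℝ) : Matrix (Sys Ω) (Sys Ω) ℂ :=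
  (update P)ᴴ * reflect (vecB P) * reflect (vecA P) * update P

end Walk

/-! ### The Wocjan–Abeyesinghe preparation

Selective phase shifts of the stationary states are approximated by phase estimation of the walks
and are combined by Grover's fixed-point (`π/3`) amplitude amplification, which drives the state
along the sequence of chains. -/

/-- `t` qubits in each phase register, `k` phase registers, `m` levels of amplification. -/
structure Params where
  t : ℕ
  k : ℕ
  m : ℕ

/-- The index set of the computational basis of the `k` phase registers. -/
abbrev Anc (p : Params) := Fin p.k → Fin (2 ^ p.t)

/-- The phase `exp(iπ/3)`. -/
def omega : ℂ := Complex.exp (Complex.I * Real.pi / 3)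

/-- The quantum Fourier transform on `t` qubits. -/
def qft (t : ℕ) : Matrix (Fin (2 ^ t)) (Fin (2 ^ t)) ℂ :=
  Matrix.of fun a b =>
    Complex.exp (2 * Real.pi * Complex.I * ((a : ℕ) * (b : ℕ) : ℂ) / 2 ^ t) / (√(2 ^ t) : ℝ)

/-- The quantum Fourier transform on each of the `k` phase registers. -/
def qftAll (p : Params) : Matrix (Anc p) (Anc p) ℂ :=
  Matrix.of fun a b => ∏ j, qft p.t (a j) (b j)

section Algorithm

variable {Ω : Type*} [Fintype Ω] [DecidableEq Ω]

/-- Each phase register controls a power of the walk: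
`|s⟩|n₁,…,n_k⟩ ↦ W^(n₁ + ⋯ + n_k) |s⟩ |n₁,…,n_k⟩`. -/
def controlledWalk (p : Params) (P : Matrix Ω Ω ℝ) :
    Matrix (Sys Ω × Anc p) (Sys Ω × Anc p) ℂ :=
  Matrix.of fun i j => if i.2 = j.2 then (walk P ^ (∑ l, (j.2 l : ℕ))) i.1 j.1 else 0

/-- `k`-fold phase estimation of the walk of `P`. -/
def phaseEstimation (p : Params) (P : Matrix Ω Ω ℝ) :
    Matrix (Sys Ω × Anc p) (Sys Ω × Anc p) ℂ :=
  ((1 : Matrix (Sys Ω) (Sys Ω) ℂ) ⊗ₖ (qftAll p)ᴴ) * controlledWalk p P *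
    ((1 : Matrix (Sys Ω) (Sys Ω) ℂ) ⊗ₖ qftAll p)

/-- Multiplies by `exp(iπ/3)` when all phase registers read `0`. -/
def phaseShift (Ω : Type*) [DecidableEq Ω] (p : Params) :
    Matrix (Sys Ω × Anc p) (Sys Ω × Anc p) ℂ :=
  Matrix.diagonal fun i => if ∀ l, (i.2 l : ℕ) = 0 then omega else 1

/-- The approximate selective phase shift of the stationary state of `P`: estimate the phases,
shift, undo the estimation. -/
def selectivePhase (p : Params) (P : Matrix Ω Ω ℝ) :
    Matrix (Sys Ω × Anc p) (Sys Ω × Anc p) ℂ :=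
  (phaseEstimation p P)ᴴ * phaseShift Ω p * phaseEstimation p P

/-- `π/3`-amplitude amplification from the stationary state of `P` to that of `P'`:
`V₀ = 1`, `V_{m+1} = V_m R_P V_m† R_{P'} V_m`. -/
def amplify (p : Params) (P P' : Matrix Ω Ω ℝ) :
    ℕ → Matrix (Sys Ω × Anc p) (Sys Ω × Anc p) ℂ
  | 0 => 1
  | m + 1 =>
    amplify p P P' m * selectivePhase p P * (amplify p P P' m)ᴴ *
      selectivePhase p P' * amplify p P P' m

/-- The coherent quantum sample `∑ₓ √π(x) |x⟩|0⟩`, with all phase registers in state `0`. -/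
def coherent (p : Params) (π : Ω → ℝ) : Sys Ω × Anc p → ℂ :=
  fun i => if i.1.2 = none ∧ ∀ l, (i.2 l : ℕ) = 0 then (√(π i.1.1) : ℝ) else 0

/-- The state reached after the first `i` stages along the chains `Qs 0, Qs 1, …`, starting from
the coherent quantum sample of the distribution `π₀`. -/
def preparedState (p : Params) (Qs : ℕ → Matrix Ω Ω ℝ) (π₀ : Ω → ℝ) :
    ℕ → Sys Ω × Anc p → ℂ
  | 0 => coherent p π₀
  | i + 1 => amplify p (Qs i) (Qs (i + 1)) p.m *ᵥ preparedState p Qs π₀ i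

/-- The distribution of the prepared sample for `Qs r`: measure the first walk register of the
state prepared along `Qs 0, …, Qs r`. -/
def preparedSample (p : Params) (Qs : ℕ → Matrix Ω Ω ℝ) (π₀ : Ω → ℝ) (r : ℕ) : Ω → ℝ :=
  fun x => ∑ a : Option Ω, ∑ n : Anc p, ‖preparedState p Qs π₀ r ((x, a), n)‖ ^ 2

end Algorithm

end QSample

end

namespace QSample

open Filter Topology

/-! ### Perturbation of stationary distributions -/

section Perturbation

variable {Ω : Type*} [Fintype Ω]

/-! The second claim is classical. If `p` is stationary for `P` and `q` for `P + E`, then `d = q -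
p` satisfies `d = dP + qE` and has entries summing to zero. Hence `‖d‖₁ ≤ τ₁(P)‖d‖₁ + ‖E‖_∞`
(`tv_stationary_le`), and the triangle inequality adds the preparation error.

The first claim is a double limit, with one phase register throughout. For fixed `m`, let the number
`t` of qubits grow. The part of the estimated state whose phase register reads `0` is the average of
the first `2 ^ t` powers of the walk. By the mean ergodic theorem it tends to the projection onto
the fixed vectors of the walk, and on `ℂ^Ω ⊗ |0⟩` this is the projection onto the stationary state
(`exists_eq_of_walk_fixed`, `tendsto_average_walk`). So the approximate phase shift tends to the
exact one on clean states; unitarity carries this through the finitely many factors of the algorithm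
(`Implements`, `tendsto_preparedState`).

For the exact algorithm, one level of amplification turns the failure probability `δ` into `δ³`
(`one_sub_norm_sq_idealAmplify_succ`). Nonzero overlaps give `δ < 1`, so as `m` grows each stage
reaches its target up to a scalar (`exists_tendsto_idealState`), to which the measurement is
insensitive in the limit (`tv_measure_le`). The argument is qualitative: no spectral gap enters. -/

theorem tv_triangle (p q s : Ω → ℝ) : tv p s ≤ tv p q + tv q s := by
  unfold tv
  rw [← mul_add, ← Finset.sum_add_distrib]
  gcongr with x
  exact abs_sub_le _ _ _

theorem sum_abs_vecMul_le (v : Ω → ℝ) (E : Matrix Ω Ω ℝ) :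
    ∑ y, |(v ᵥ* E) y| ≤ ∑ x, |v x| * ∑ y, |E x y| := by
  calc ∑ y, |(v ᵥ* E) y| ≤ ∑ y, ∑ x, |v x| * |E x y| := by
        refine Finset.sum_le_sum fun y _ => ?_
        refine (Finset.abs_sum_le_sum_abs _ _).trans_eq ?_
        simp [abs_mul]
    _ = ∑ x, |v x| * ∑ y, |E x y| := by
        rw [Finset.sum_comm]; simp [Finset.mul_sum]

theorem sum_abs_row_le_infNorm (E : Matrix Ω Ω ℝ) (x : Ω) : ∑ y, |E x y| ≤ infNorm E :=
  le_ciSup (f := fun x => ∑ y, |E x y|) (Set.finite_range _).bddAbove x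

theorem sum_abs_vecMul_le_infNorm {p : Ω → ℝ} (hp : p ∈ stdSimplex ℝ Ω) (E : Matrix Ω Ω ℝ) :
    ∑ y, |(p ᵥ* E) y| ≤ infNorm E := by
  refine (sum_abs_vecMul_le p E).trans ?_
  calc ∑ x, |p x| * ∑ y, |E x y| ≤ ∑ x, p x * infNorm E := by
        refine Finset.sum_le_sum fun x _ => ?_
        rw [abs_of_nonneg (hp.1 x)]
        exact mul_le_mul_of_nonneg_left (sum_abs_row_le_infNorm E x) (hp.1 x)
    _ = infNorm E := by rw [← Finset.sum_mul, hp.2, one_mul]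

variable [DecidableEq Ω]

/-- Homogeneity: scale `v` to norm one, treating `v = 0` apart. -/
theorem sum_abs_vecMul_le_tau₁ {P : Matrix Ω Ω ℝ} (hP : P ∈ Matrix.rowStochastic ℝ Ω)
    {v : Ω → ℝ} (hv : ∑ x, v x = 0) :
    ∑ y, |(v ᵥ* P) y| ≤ tau₁ P * ∑ x, |v x| := by
  -- Without an upper bound the real `sSup` would be the default value `0`; a stochastic matrix does
  -- not increase the `l₁` norm.
  have hbdd : BddAbove
      {s | ∃ v : Ω → ℝ, ∑ x, |v x| = 1 ∧ ∑ x, v x = 0 ∧ s = ∑ y, |(v ᵥ* P) y|} := by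
    refine ⟨1, ?_⟩
    rintro _ ⟨w, hw, -, rfl⟩
    refine (sum_abs_vecMul_le w P).trans_eq ?_
    rw [← hw]
    refine Finset.sum_congr rfl fun x _ => ?_
    rw [Finset.sum_congr rfl fun y _ => abs_of_nonneg (hP.1 x y),
      Matrix.sum_row_of_mem_rowStochastic hP, mul_one]
  rcases (Finset.sum_nonneg fun x _ => abs_nonneg (v x) : 0 ≤ ∑ x, |v x|).eq_or_lt with h | h
  · have : v = 0 := funext fun x => by
      simpa using (Finset.sum_eq_zero_iff_of_nonneg fun x _ => abs_nonneg (v x)).1 h.symm x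
        (Finset.mem_univ x)
    simp [this]
  · set N := ∑ x, |v x| with hN
    have key : ∑ y, |((N⁻¹ • v) ᵥ* P) y| ≤ tau₁ P := by
      refine le_csSup hbdd ⟨N⁻¹ • v, ?_, ?_, rfl⟩
      · simp only [Pi.smul_apply, smul_eq_mul, abs_mul, ← Finset.mul_sum, abs_inv, abs_of_pos h]
        exact inv_mul_cancel₀ h.ne'
      · simp [← Finset.mul_sum, hv]
    simp only [Matrix.smul_vecMul, Pi.smul_apply, smul_eq_mul, abs_mul, ← Finset.mul_sum, abs_inv,
      abs_of_pos h] at key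
    rwa [inv_mul_le_iff₀ h, mul_comm] at key

/-- The stationary distribution is stable under perturbations of the transition matrix. -/
theorem tv_stationary_le {P E : Matrix Ω Ω ℝ} (hP : P ∈ Matrix.rowStochastic ℝ Ω)
    (hτ : tau₁ P < 1) {p q : Ω → ℝ} (hp : IsStationary P p) (hq : IsStationary (P + E) q) :
    tv q p ≤ infNorm E / (2 * (1 - tau₁ P)) := by
  have hd : q - p = (q - p) ᵥ* P + q ᵥ* E := by
    rw [Matrix.sub_vecMul, hp.2]
    conv_lhs => rw [← hq.2, Matrix.vecMul_add]
    abel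
  have hsum : ∑ x, (q - p) x = 0 := by
    simp [Finset.sum_sub_distrib, hp.1.2, hq.1.2]
  have h : ∑ x, |(q - p) x| ≤ tau₁ P * ∑ x, |(q - p) x| + infNorm E := by
    calc ∑ x, |(q - p) x| = ∑ x, |((q - p) ᵥ* P) x + (q ᵥ* E) x| := by
          conv_lhs => rw [hd]
          rfl
      _ ≤ ∑ x, |((q - p) ᵥ* P) x| + ∑ x, |(q ᵥ* E) x| := by
          rw [← Finset.sum_add_distrib]
          exact Finset.sum_le_sum fun x _ => abs_add_le _ _
      _ ≤ _ := add_le_add (sum_abs_vecMul_le_tau₁ hP hsum) (sum_abs_vecMul_le_infNorm hq.1 E)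
  rw [tv, le_div_iff₀ (by linarith)]
  simp only [Pi.sub_apply] at h
  linarith

end Perturbation

/-! ### Ergodic reversible chains -/

section Ergodic

variable {Ω : Type*} [Fintype Ω] [DecidableEq Ω]

theorem IsStationary.pow {P : Matrix Ω Ω ℝ} {p : Ω → ℝ} (h : IsStationary P p) (n : ℕ) :
    p ᵥ* P ^ n = p := by
  induction n with
  | zero => simp
  | succ n ih => rw [pow_succ, ← Matrix.vecMul_vecMul, ih, h.2]

/-- Some power of `P` has only positive entries and still fixes `p`, so mass at one state spreads to
all of them. -/
theorem IsStationary.pos {P : Matrix Ω Ω ℝ} {p : Ω → ℝ} (h : IsStationary P p)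
    (hP : P.IsPrimitive) (x : Ω) : 0 < p x := by
  obtain ⟨n, -, hn⟩ := hP.exists_pos_pow
  have hne : ∃ z, 0 < p z := by
    by_contra! hcon
    have := Finset.sum_nonpos fun z (_ : z ∈ Finset.univ) => hcon z
    rw [h.1.2] at this
    linarith
  obtain ⟨z, hz⟩ := hne
  rw [← h.pow n]
  exact Finset.sum_pos' (fun y _ => mul_nonneg (h.1.1 y) (hn y x).le)
    ⟨z, Finset.mem_univ _, mul_pos hz (hn z x)⟩

/-- Two functions that agree across the edges of a primitive chain with symmetric support are
constant. -/
theorem eq_of_forall_edge {α : Type*} {P : Matrix Ω Ω ℝ} (hP : P.IsPrimitive) {f g : Ω → α}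
    (hsymm : ∀ x y, 0 < P x y → 0 < P y x) (hfg : ∀ x y, 0 < P x y → f x = g y) (x y : Ω) :
    f x = f y := by
  -- Along a path of length `n` the values alternate between `f` and `g`; the two cases are even and
  -- odd `n`.
  have step : ∀ n, (∀ x z, 0 < (P ^ n) x z → f x = f z ∧ g x = g z) ∨
      (∀ x z, 0 < (P ^ n) x z → f x = g z ∧ g x = f z) := by
    intro n
    induction n with
    | zero =>
      refine Or.inl fun x z hxz => ?_
      by_cases h : x = z
      · simp [h]
      · simp [h] at hxz
    | succ n ih =>
      have split : ∀ x z, 0 < (P ^ (n + 1)) x z → ∃ w, 0 < (P ^ n) x w ∧ 0 < P w z := by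
        intro x z hxz
        rw [pow_succ, Matrix.mul_apply] at hxz
        obtain ⟨w, -, hw⟩ := Finset.exists_lt_of_sum_lt (s := Finset.univ)
          (f := fun _ => (0 : ℝ)) (by simpa using hxz)
        have hwz : 0 < P w z := (hP.nonneg w z).lt_of_ne fun h => by simp [← h] at hw
        exact ⟨w, pos_of_mul_pos_left hw hwz.le, hwz⟩
      rcases ih with ih | ih
      · refine Or.inr fun x z hxz => ?_
        obtain ⟨w, hxw, hwz⟩ := split x z hxz
        exact ⟨(ih x w hxw).1.trans (hfg w z hwz),
          (ih x w hxw).2.trans (hfg z w (hsymm w z hwz)).symm⟩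
      · refine Or.inl fun x z hxz => ?_
        obtain ⟨w, hxw, hwz⟩ := split x z hxz
        exact ⟨(ih x w hxw).1.trans (hfg z w (hsymm w z hwz)).symm,
          (ih x w hxw).2.trans (hfg w z hwz)⟩
  obtain ⟨n, -, hn⟩ := hP.exists_pos_pow
  rcases step n with h | h
  · exact (h x y (hn x y)).1
  -- At odd length, `f x = g y`, and the loop at `y`, which positivity of the power provides, gives
  -- `f y = g y`.
  · exact (h x y (hn x y)).1.trans (h y y (hn y y)).1.symm

end Ergodic

/-! ### Euclidean norms and unitary matrices -/

section Norm

variable {ι : Type*} [Fintype ι]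

/-- The Euclidean norm of a vector of amplitudes. -/
noncomputable def l2norm (v : ι → ℂ) : ℝ := ‖WithLp.toLp 2 v‖

theorem l2norm_nonneg (v : ι → ℂ) : 0 ≤ l2norm v := norm_nonneg _

theorem l2norm_sq (v : ι → ℂ) : l2norm v ^ 2 = ∑ i, ‖v i‖ ^ 2 := by
  simp [l2norm, EuclideanSpace.norm_sq_eq]

theorem l2norm_add_le (u v : ι → ℂ) : l2norm (u + v) ≤ l2norm u + l2norm v :=
  norm_add_le (WithLp.toLp 2 u) (WithLp.toLp 2 v)

theorem l2norm_smul (z : ℂ) (v : ι → ℂ) : l2norm (z • v) = ‖z‖ * l2norm v :=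
  norm_smul z (WithLp.toLp 2 v)

theorem l2norm_sub_le_add (u v w : ι → ℂ) :
    l2norm (u - w) ≤ l2norm (u - v) + l2norm (v - w) := by
  simpa using l2norm_add_le (u - v) (v - w)

theorem abs_l2norm_sub_le (u v : ι → ℂ) : |l2norm u - l2norm v| ≤ l2norm (u - v) :=
  abs_norm_sub_norm_le (WithLp.toLp 2 u) (WithLp.toLp 2 v)

theorem l2norm_sq_eq_dotProduct (v : ι → ℂ) : ((l2norm v ^ 2 : ℝ) : ℂ) = star v ⬝ᵥ v := by
  rw [l2norm_sq]
  simp [dotProduct, Complex.conj_mul']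

variable [DecidableEq ι]

theorem star_mulVec_dotProduct_mulVec {U : Matrix ι ι ℂ} (hU : U ∈ Matrix.unitaryGroup ι ℂ)
    (u v : ι → ℂ) : star (U *ᵥ u) ⬝ᵥ (U *ᵥ v) = star u ⬝ᵥ v := by
  have h : Uᴴ * U = 1 := Matrix.mem_unitaryGroup_iff'.1 hU
  rw [Matrix.star_mulVec, Matrix.dotProduct_mulVec, Matrix.vecMul_vecMul, h, Matrix.vecMul_one]

theorem l2norm_mulVec {U : Matrix ι ι ℂ} (hU : U ∈ Matrix.unitaryGroup ι ℂ) (v : ι → ℂ) :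
    l2norm (U *ᵥ v) = l2norm v := by
  have h : l2norm (U *ᵥ v) ^ 2 = l2norm v ^ 2 := by
    have := star_mulVec_dotProduct_mulVec hU v v
    rw [← l2norm_sq_eq_dotProduct, ← l2norm_sq_eq_dotProduct] at this
    exact_mod_cast this
  exact (sq_eq_sq₀ (l2norm_nonneg _) (l2norm_nonneg _)).1 h

theorem conjTranspose_mem_unitaryGroup {U : Matrix ι ι ℂ} (hU : U ∈ Matrix.unitaryGroup ι ℂ) :
    Uᴴ ∈ Matrix.unitaryGroup ι ℂ := Unitary.star_mem hU

end Norm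

/-! ### Unitarity of the quantum walk -/

section WalkUnitary

variable {Ω : Type*} [DecidableEq Ω]

theorem conjTranspose_update (P : Matrix Ω Ω ℝ) : (update P)ᴴ = update P := by
  ext ⟨x, a⟩ ⟨y, b⟩
  by_cases h : x = y
  · subst h
    simp only [update, Matrix.conjTranspose_apply, Matrix.of_apply, if_true, star_sub, star_mul,
      star_star]
    simp only [eq_comm, apply_ite star, star_one, star_zero]
  · simp [update, h, Ne.symm h]

variable [Fintype Ω]

theorem sum_amp_mul_star_amp {P : Matrix Ω Ω ℝ} (hP : P ∈ Matrix.rowStochastic ℝ Ω) (x : Ω) :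
    ∑ a, star (amp P x a) * amp P x a = 1 := by
  rw [Fintype.sum_option]
  simp only [amp, star_zero, zero_mul, zero_add]
  have : ∀ y, star ((√(P x y) : ℝ) : ℂ) * ((√(P x y) : ℝ) : ℂ) = (P x y : ℝ) := fun y => by
    rw [Complex.star_def, Complex.conj_ofReal, ← Complex.ofReal_mul,
      Real.mul_self_sqrt (hP.1 x y)]
  rw [Finset.sum_congr rfl fun y _ => this y, ← Complex.ofReal_sum,
    Matrix.sum_row_of_mem_rowStochastic hP, Complex.ofReal_one]

theorem sum_star_householder_mul {P : Matrix Ω Ω ℝ} (x : Ω) (f : Option Ω → ℂ) :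
    ∑ a, star (householder P x a) * f a = f none - ∑ a, star (amp P x a) * f a := by
  simp [householder, sub_mul, Finset.sum_sub_distrib, ite_mul]

theorem sum_star_householder_mul_self {P : Matrix Ω Ω ℝ} (hP : P ∈ Matrix.rowStochastic ℝ Ω)
    (x : Ω) : ∑ a, star (householder P x a) * householder P x a = 2 := by
  rw [sum_star_householder_mul]
  have : ∀ a, star (amp P x a) * householder P x a =
      (if a = none then star (amp P x a) else 0) - star (amp P x a) * amp P x a := fun a => by
    simp only [householder, mul_sub, mul_ite, mul_one, mul_zero]
  rw [Finset.sum_congr rfl fun a _ => this a, Finset.sum_sub_distrib, sum_amp_mul_star_amp hP]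
  simp [householder, amp]
  norm_num

theorem update_mulVec (P : Matrix Ω Ω ℝ) (v : Sys Ω → ℂ) (x : Ω) (b : Option Ω) :
    (update P *ᵥ v) (x, b) =
      v (x, b) - householder P x b * ∑ a, star (householder P x a) * v (x, a) := by
  simp only [update, Matrix.mulVec, dotProduct, Matrix.of_apply, Fintype.sum_prod_type, ite_mul,
    zero_mul]
  rw [Finset.sum_eq_single x (by intro y _ hy; simp [hy.symm]) (by simp)]
  simp only [if_true, sub_mul, Finset.sum_sub_distrib, Finset.mul_sum, mul_assoc, ite_mul, one_mul,
    zero_mul, Finset.sum_ite_eq, Finset.mem_univ]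

/-- The Householder vector is a difference of two orthogonal unit vectors, so its squared norm is
`2` and `1 - h h†` is an involution. -/
theorem update_mul_self {P : Matrix Ω Ω ℝ} (hP : P ∈ Matrix.rowStochastic ℝ Ω) :
    update P * update P = 1 := by
  refine Matrix.ext_of_mulVec_single fun i => ?_
  generalize (Pi.single i 1 : Sys Ω → ℂ) = v
  ext ⟨x, b⟩
  rw [← Matrix.mulVec_mulVec, update_mulVec, Matrix.one_mulVec]
  have h : ∀ a, star (householder P x a) * (update P *ᵥ v) (x, a) =
      star (householder P x a) * v (x, a) - star (householder P x a) * householder P x a *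
        ∑ a, star (householder P x a) * v (x, a) := fun a => by
    rw [update_mulVec]; ring
  rw [Finset.sum_congr rfl fun a _ => h a, Finset.sum_sub_distrib, ← Finset.sum_mul,
    sum_star_householder_mul_self hP, update_mulVec]
  ring

theorem update_mem_unitaryGroup {P : Matrix Ω Ω ℝ} (hP : P ∈ Matrix.rowStochastic ℝ Ω) :
    update P ∈ Matrix.unitaryGroup (Sys Ω) ℂ := by
  rw [Matrix.mem_unitaryGroup_iff, Matrix.star_eq_conjTranspose, conjTranspose_update,
    update_mul_self hP]

theorem vecA_orthonormal {P : Matrix Ω Ω ℝ} (hP : P ∈ Matrix.rowStochastic ℝ Ω) (x y : Ω) :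
    star (vecA P x) ⬝ᵥ vecA P y = if x = y then 1 else 0 := by
  simp only [dotProduct, vecA, Pi.star_apply, Fintype.sum_prod_type]
  rw [Finset.sum_eq_single x (by intro z _ hz; simp [hz]) (by simp)]
  by_cases h : x = y
  · subst h
    simpa using sum_amp_mul_star_amp hP x
  · simp [h]

theorem vecB_orthonormal {P : Matrix Ω Ω ℝ} (hP : P ∈ Matrix.rowStochastic ℝ Ω) (x y : Ω) :
    star (vecB P x) ⬝ᵥ vecB P y = if x = y then 1 else 0 := by
  simp only [dotProduct, vecB, Pi.star_apply]
  rw [Fintype.sum_prod_type_right,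
    Finset.sum_eq_single (some x) (by intro z _ hz; simp [hz]) (by simp)]
  split_ifs with h
  · subst h
    have := sum_amp_mul_star_amp hP x
    rw [Fintype.sum_option] at this
    simpa [amp] using this
  · simp [h]

theorem conjTranspose_reflect (v : Ω → Sys Ω → ℂ) : (reflect v)ᴴ = reflect v := by
  simp [reflect, Matrix.conjTranspose_sum, Matrix.conjTranspose_vecMulVec]

theorem reflect_mulVec (v : Ω → Sys Ω → ℂ) (u : Sys Ω → ℂ) :
    reflect v *ᵥ u = (2 : ℂ) • ∑ x, (star (v x) ⬝ᵥ u) • v x - u := by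
  simp [reflect, Matrix.sub_mulVec, Matrix.smul_mulVec, Matrix.sum_mulVec,
    Matrix.vecMulVec_mulVec]

theorem reflect_mulVec_sum {v : Ω → Sys Ω → ℂ}
    (hv : ∀ x y, star (v x) ⬝ᵥ v y = if x = y then 1 else 0) (c : Ω → ℂ) :
    reflect v *ᵥ (∑ x, c x • v x) = ∑ x, c x • v x := by
  have : ∀ x, star (v x) ⬝ᵥ (∑ y, c y • v y) = c x := fun x => by
    simp [dotProduct_sum, hv]
  rw [reflect_mulVec, Finset.sum_congr rfl fun x _ => by rw [this x], two_smul,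
    add_sub_cancel_right]

theorem reflect_mul_self {v : Ω → Sys Ω → ℂ}
    (hv : ∀ x y, star (v x) ⬝ᵥ v y = if x = y then 1 else 0) :
    reflect v * reflect v = 1 := by
  refine Matrix.ext_of_mulVec_single fun i => ?_
  generalize (Pi.single i 1 : Sys Ω → ℂ) = u
  rw [← Matrix.mulVec_mulVec, reflect_mulVec v u, Matrix.mulVec_sub, Matrix.mulVec_smul,
    reflect_mulVec_sum hv, reflect_mulVec, Matrix.one_mulVec]
  abel

theorem reflect_mem_unitaryGroup {v : Ω → Sys Ω → ℂ}
    (hv : ∀ x y, star (v x) ⬝ᵥ v y = if x = y then 1 else 0) :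
    reflect v ∈ Matrix.unitaryGroup (Sys Ω) ℂ := by
  rw [Matrix.mem_unitaryGroup_iff, Matrix.star_eq_conjTranspose, conjTranspose_reflect,
    reflect_mul_self hv]

theorem walk_mem_unitaryGroup {P : Matrix Ω Ω ℝ} (hP : P ∈ Matrix.rowStochastic ℝ Ω) :
    walk P ∈ Matrix.unitaryGroup (Sys Ω) ℂ :=
  mul_mem (mul_mem (mul_mem (conjTranspose_mem_unitaryGroup (update_mem_unitaryGroup hP))
    (reflect_mem_unitaryGroup (vecB_orthonormal hP)))
    (reflect_mem_unitaryGroup (vecA_orthonormal hP))) (update_mem_unitaryGroup hP)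

end WalkUnitary

/-! ### Unitarity of the phase estimation -/

section PhaseUnitary

theorem norm_omega : ‖omega‖ = 1 := by
  rw [omega, show Complex.I * Real.pi / 3 = ((Real.pi / 3 : ℝ) : ℂ) * Complex.I by
    push_cast; ring, Complex.norm_exp_ofReal_mul_I]

theorem omega_mul_star : omega * star omega = 1 := by
  rw [Complex.star_def, Complex.mul_conj']
  simp [norm_omega]

/-- The inner product of two rows is a geometric sum over powers of a `2 ^ t`-th root of unity,
which vanishes unless the root is `1`. -/
theorem qft_mem_unitaryGroup (t : ℕ) : qft t ∈ Matrix.unitaryGroup (Fin (2 ^ t)) ℂ := by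
  rw [Matrix.mem_unitaryGroup_iff]
  ext a b
  have hT : ((2 : ℂ) ^ t) ≠ 0 := pow_ne_zero _ two_ne_zero
  have hs : (((√(2 ^ t) : ℝ) : ℂ)) * ((√(2 ^ t) : ℝ) : ℂ) = 2 ^ t := by
    rw [← Complex.ofReal_mul, Real.mul_self_sqrt (by positivity)]; simp
  set w : ℂ := Complex.exp (2 * Real.pi * Complex.I * (((a : ℕ) : ℂ) - ((b : ℕ) : ℂ)) / 2 ^ t)
    with hw
  have hterm : ∀ j : Fin (2 ^ t), qft t a j * star (qft t b j) = w ^ (j : ℕ) / 2 ^ t := by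
    intro j
    simp only [qft, Matrix.of_apply, Complex.star_def, map_div₀, ← Complex.exp_conj,
      Complex.conj_ofReal]
    rw [div_mul_div_comm, hs, ← Complex.exp_add, hw, ← Complex.exp_nat_mul]
    congr 2
    simp [Complex.conj_ofNat]
    ring
  simp only [Matrix.mul_apply, Matrix.star_apply, hterm, ← Finset.sum_div]
  rw [Fin.sum_univ_eq_sum_range (fun j => w ^ j)]
  by_cases hab : a = b
  · subst hab
    simp [hw, hT]
  · have hwT : w ^ (2 ^ t) = 1 := by
      rw [hw, ← Complex.exp_nat_mul, Complex.exp_eq_one_iff]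
      refine ⟨((a : ℕ) : ℤ) - ((b : ℕ) : ℤ), ?_⟩
      push_cast
      field_simp
    have hw1 : w ≠ 1 := by
      rw [hw, Ne, Complex.exp_eq_one_iff]
      rintro ⟨n, hn⟩
      have h2 : (((a : ℕ) : ℂ) - ((b : ℕ) : ℂ)) = n * 2 ^ t := by
        have := Complex.two_pi_I_ne_zero
        field_simp at hn
        linear_combination hn
      have h3 : ((a : ℕ) : ℤ) - ((b : ℕ) : ℤ) = n * 2 ^ t := by exact_mod_cast h2
      have ha : ((a : ℕ) : ℤ) < 2 ^ t := by exact_mod_cast a.2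
      have hb : ((b : ℕ) : ℤ) < 2 ^ t := by exact_mod_cast b.2
      -- Both indices lie in `[0, 2 ^ t)`, so their difference is a multiple of `2 ^ t` only if it
      -- is zero.
      have hn0 : n = 0 := by
        by_contra hne
        rcases lt_or_gt_of_ne hne with h | h <;> nlinarith
      refine hab (Fin.ext ?_)
      simp [hn0] at h3
      omega
    have hg := mul_geom_sum w (2 ^ t)
    rw [hwT, sub_self, mul_eq_zero, or_iff_right (sub_ne_zero.2 hw1)] at hg
    simp [hg, hab]

theorem qftAll_mem_unitaryGroup (p : Params) : qftAll p ∈ Matrix.unitaryGroup (Anc p) ℂ := by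
  rw [Matrix.mem_unitaryGroup_iff]
  ext a b
  have h : ∀ l, ∑ j, qft p.t (a l) j * star (qft p.t (b l) j) = if a l = b l then 1 else 0 := by
    intro l
    have := congrFun (congrFun (Matrix.mem_unitaryGroup_iff.1 (qft_mem_unitaryGroup p.t)) (a l))
      (b l)
    simpa [Matrix.mul_apply, Matrix.one_apply] using this
  simp only [Matrix.mul_apply, Matrix.star_apply, qftAll, Matrix.of_apply, star_prod,
    ← Finset.prod_mul_distrib]
  rw [← Fintype.prod_sum (fun l j => qft p.t (a l) j * star (qft p.t (b l) j)),
    Finset.prod_congr rfl fun l _ => h l, Finset.prod_ite_zero, Matrix.one_apply]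
  simp [funext_iff]

variable {Ω : Type*} [Fintype Ω] [DecidableEq Ω]

theorem controlledWalk_eq (p : Params) (P : Matrix Ω Ω ℝ) :
    controlledWalk p P = Matrix.blockDiagonal fun n : Anc p => walk P ^ (∑ l, (n l : ℕ)) := by
  ext ⟨i, a⟩ ⟨j, b⟩
  by_cases h : a = b
  · subst h; simp [controlledWalk]
  · simp [controlledWalk, Matrix.blockDiagonal_apply, h]

theorem controlledWalk_mem_unitaryGroup (p : Params) {P : Matrix Ω Ω ℝ}
    (hP : P ∈ Matrix.rowStochastic ℝ Ω) :
    controlledWalk p P ∈ Matrix.unitaryGroup (Sys Ω × Anc p) ℂ := by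
  rw [controlledWalk_eq, Matrix.mem_unitaryGroup_iff, Matrix.star_eq_conjTranspose,
    Matrix.blockDiagonal_conjTranspose, ← Matrix.blockDiagonal_mul, ← Matrix.blockDiagonal_one]
  congr 1
  ext1 n
  exact Matrix.mem_unitaryGroup_iff.1 (pow_mem (walk_mem_unitaryGroup hP) _)

theorem phaseEstimation_mem_unitaryGroup (p : Params) {P : Matrix Ω Ω ℝ}
    (hP : P ∈ Matrix.rowStochastic ℝ Ω) :
    phaseEstimation p P ∈ Matrix.unitaryGroup (Sys Ω × Anc p) ℂ :=
  mul_mem (mul_mem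
    (Matrix.kronecker_mem_unitary (one_mem _)
      (conjTranspose_mem_unitaryGroup (qftAll_mem_unitaryGroup p)))
    (controlledWalk_mem_unitaryGroup p hP))
    (Matrix.kronecker_mem_unitary (one_mem _) (qftAll_mem_unitaryGroup p))

theorem phaseShift_mem_unitaryGroup (p : Params) :
    phaseShift Ω p ∈ Matrix.unitaryGroup (Sys Ω × Anc p) ℂ := by
  rw [Matrix.mem_unitaryGroup_iff, phaseShift, Matrix.star_eq_conjTranspose,
    Matrix.diagonal_conjTranspose, Matrix.diagonal_mul_diagonal, ← Matrix.diagonal_one]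
  congr 1
  ext1 i
  by_cases h : ∀ l, (i.2 l : ℕ) = 0
  · simpa only [Pi.star_apply, if_pos h] using omega_mul_star
  · simp only [Pi.star_apply, if_neg h, star_one, mul_one]

theorem selectivePhase_mem_unitaryGroup (p : Params) {P : Matrix Ω Ω ℝ}
    (hP : P ∈ Matrix.rowStochastic ℝ Ω) :
    selectivePhase p P ∈ Matrix.unitaryGroup (Sys Ω × Anc p) ℂ :=
  mul_mem (mul_mem (conjTranspose_mem_unitaryGroup (phaseEstimation_mem_unitaryGroup p hP))
    (phaseShift_mem_unitaryGroup p)) (phaseEstimation_mem_unitaryGroup p hP)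

theorem amplify_mem_unitaryGroup (p : Params) {P P' : Matrix Ω Ω ℝ}
    (hP : P ∈ Matrix.rowStochastic ℝ Ω) (hP' : P' ∈ Matrix.rowStochastic ℝ Ω) (m : ℕ) :
    amplify p P P' m ∈ Matrix.unitaryGroup (Sys Ω × Anc p) ℂ := by
  induction m with
  | zero => exact one_mem _
  | succ m ih =>
    exact mul_mem (mul_mem (mul_mem (mul_mem ih (selectivePhase_mem_unitaryGroup p hP))
      (conjTranspose_mem_unitaryGroup ih)) (selectivePhase_mem_unitaryGroup p hP')) ih

end PhaseUnitary

/-! ### Fixed vectors of the walk and the mean ergodic theorem -/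

section Embedding

variable {Ω : Type*}

/-- The amplitudes `√p(x)` of the coherent state of `p`. -/
noncomputable def sqrtVec (p : Ω → ℝ) : Ω → ℂ := fun x => (√(p x) : ℝ)

/-- The vector `ψ ⊗ |0⟩` in the walk registers. -/
def embWalk (ψ : Ω → ℂ) : Sys Ω → ℂ := fun s => if s.2 = none then ψ s.1 else 0

theorem star_sqrtVec (p : Ω → ℝ) : star (sqrtVec p) = sqrtVec p := by
  ext x; simp [sqrtVec]

variable [Fintype Ω]

theorem sqrtVec_dotProduct_self {p : Ω → ℝ} (hp : p ∈ stdSimplex ℝ Ω) :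
    star (sqrtVec p) ⬝ᵥ sqrtVec p = 1 := by
  rw [star_sqrtVec]
  simp only [dotProduct, sqrtVec, ← Complex.ofReal_mul, Real.mul_self_sqrt (hp.1 _)]
  rw [← Complex.ofReal_sum, hp.2, Complex.ofReal_one]

theorem embWalk_dotProduct (ψ : Ω → ℂ) (v : Sys Ω → ℂ) :
    star (embWalk ψ) ⬝ᵥ v = ∑ x, star (ψ x) * v (x, none) := by
  simp [dotProduct, embWalk, Fintype.sum_prod_type, Fintype.sum_option]

end Embedding

section FixedVectors

variable {Ω : Type*} [Fintype Ω] [DecidableEq Ω]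

theorem update_mulVec_embWalk (P : Matrix Ω Ω ℝ) (ψ : Ω → ℂ) :
    update P *ᵥ embWalk ψ = ∑ x, ψ x • vecA P x := by
  ext ⟨x, b⟩
  rw [update_mulVec, sum_star_householder_mul, Finset.sum_apply,
    Finset.sum_eq_single x (by intro z _ hz; simp [vecA, hz.symm]) (by simp), Fintype.sum_option]
  simp only [embWalk, if_true, amp, star_zero, zero_mul, reduceCtorEq, if_false, mul_zero,
    Finset.sum_const_zero, add_zero, sub_zero, Pi.smul_apply, vecA, smul_eq_mul]
  cases b <;> simp [householder, amp, mul_comm]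

theorem star_vecA_dotProduct_update {P : Matrix Ω Ω ℝ} (hP : P ∈ Matrix.rowStochastic ℝ Ω)
    (v : Sys Ω → ℂ) (x : Ω) : star (vecA P x) ⬝ᵥ (update P *ᵥ v) = v (x, none) := by
  have h : vecA P x = update P *ᵥ embWalk (Pi.single x 1) := by
    rw [update_mulVec_embWalk]
    simp [Pi.single_apply]
  rw [h, star_mulVec_dotProduct_mulVec (update_mem_unitaryGroup hP), embWalk_dotProduct]
  simp [Pi.single_apply, apply_ite star]

/-- Taking square roots in detailed balance shows that `∑ √p(x) |x⟩|p_x⟩ = ∑ √p(y) |p_y⟩|y⟩`. This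
vector lies in both subspaces, so both reflections fix it. -/
theorem walk_mulVec_embWalk_sqrtVec {P : Matrix Ω Ω ℝ} (hP : P ∈ Matrix.rowStochastic ℝ Ω)
    {p : Ω → ℝ} (hp : ∀ x, 0 ≤ p x) (hrev : IsReversible P p) :
    walk P *ᵥ embWalk (sqrtVec p) = embWalk (sqrtVec p) := by
  have hB : ∑ x, sqrtVec p x • vecA P x = ∑ y, sqrtVec p y • vecB P y := by
    ext ⟨x, b⟩
    rw [Finset.sum_apply, Finset.sum_apply,
      Finset.sum_eq_single x (by intro z _ hz; simp [vecA, hz.symm]) (by simp)]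
    cases b with
    | none => simp [vecA, vecB, amp]
    | some y =>
      rw [Finset.sum_eq_single y (by intro z _ hz; simp [vecB, hz.symm]) (by simp)]
      simp only [sqrtVec, vecA, vecB, amp, Pi.smul_apply, if_true, smul_eq_mul,
        ← Complex.ofReal_mul, ← Real.sqrt_mul (hp _), hrev x y]
  rw [walk, ← Matrix.mulVec_mulVec, ← Matrix.mulVec_mulVec, ← Matrix.mulVec_mulVec,
    update_mulVec_embWalk, reflect_mulVec_sum (vecA_orthonormal hP), hB,
    reflect_mulVec_sum (vecB_orthonormal hP), ← hB, ← update_mulVec_embWalk,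
    Matrix.mulVec_mulVec, conjTranspose_update, update_mul_self hP, Matrix.one_mulVec]

/-- A fixed vector of the walk overlaps the initial space `ℂ^Ω ⊗ |0⟩` only in the stationary
state. -/
theorem exists_eq_of_walk_fixed {P : Matrix Ω Ω ℝ} (hP : P ∈ Matrix.rowStochastic ℝ Ω)
    (hprim : P.IsPrimitive) {p : Ω → ℝ} (hp : IsStationary P p) (hrev : IsReversible P p)
    {v : Sys Ω → ℂ} (hv : walk P *ᵥ v = v) : ∃ C : ℂ, ∀ x, v (x, none) = C * sqrtVec p x := by
  set u := update P *ᵥ v with hu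
  -- A fixed vector satisfies `ref_B ref_A u = u`; since `ref_B` is an involution, the two
  -- reflections, and hence the two projections, agree on `u`.
  have hfix : reflect (vecA P) *ᵥ u = reflect (vecB P) *ᵥ u := by
    have h1 : update P *ᵥ (walk P *ᵥ v) = reflect (vecB P) *ᵥ (reflect (vecA P) *ᵥ u) := by
      rw [walk, conjTranspose_update, Matrix.mulVec_mulVec, ← mul_assoc, ← mul_assoc, ← mul_assoc,
        update_mul_self hP, one_mul, hu, Matrix.mulVec_mulVec, Matrix.mulVec_mulVec, mul_assoc]
    rw [hv, ← hu] at h1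
    conv_rhs => rw [h1]
    rw [Matrix.mulVec_mulVec (M := reflect (vecB P)), reflect_mul_self (vecB_orthonormal hP), Matrix.one_mulVec]
  set a : Ω → ℂ := fun x => star (vecA P x) ⬝ᵥ u with ha
  set b : Ω → ℂ := fun x => star (vecB P x) ⬝ᵥ u with hb
  have hav : ∀ x, a x = v (x, none) := fun x => star_vecA_dotProduct_update hP v x
  have hproj : ∑ x, a x • vecA P x = ∑ y, b y • vecB P y := by
    rw [reflect_mulVec, reflect_mulVec, sub_left_inj] at hfix
    exact smul_right_injective _ two_ne_zero hfix
  have hedge : ∀ x y, a x * (√(P x y) : ℝ) = b y * (√(P y x) : ℝ) := by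
    intro x y
    have h := congrFun hproj (x, some y)
    rw [Finset.sum_apply, Finset.sum_apply,
      Finset.sum_eq_single x (by intro z _ hz; simp [vecA, hz.symm]) (by simp),
      Finset.sum_eq_single y (by intro z _ hz; simp [vecB, hz.symm]) (by simp)] at h
    simpa [vecA, vecB, amp] using h
  have hpos := hp.pos hprim
  have hsymm : ∀ x y, 0 < P x y → 0 < P y x := fun x y h => by
    have := mul_pos (hpos x) h
    rw [hrev x y] at this
    exact pos_of_mul_pos_right this (hpos y).le
  have hne : ∀ x, sqrtVec p x ≠ 0 := fun x => by
    simpa [sqrtVec] using (Real.sqrt_pos.2 (hpos x)).ne'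
  -- Dividing the edge relation by detailed balance makes `a / √p` at one end of an edge equal to `b
  -- / √p` at the other.
  have hconst := eq_of_forall_edge hprim (f := fun x => a x / sqrtVec p x)
    (g := fun y => b y / sqrtVec p y) hsymm (by
      intro x y hxy
      have h1 := hedge x y
      have h2 : sqrtVec p x * (√(P x y) : ℝ) = sqrtVec p y * (√(P y x) : ℝ) := by
        simp only [sqrtVec, ← Complex.ofReal_mul, ← Real.sqrt_mul (hpos _).le, hrev x y]
      have h3 : ((√(P x y) : ℝ) : ℂ) ≠ 0 := by
        simpa using (Real.sqrt_pos.2 hxy).ne'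
      rw [div_eq_div_iff (hne x) (hne y)]
      refine mul_right_cancel₀ h3 ?_
      linear_combination sqrtVec p y * h1 - b y * h2)
  rcases isEmpty_or_nonempty Ω with hΩ | ⟨⟨z⟩⟩
  · exact ⟨0, fun x => hΩ.elim x⟩
  · refine ⟨a z / sqrtVec p z, fun x => ?_⟩
    rw [← hav, ← hconst x z, div_mul_cancel₀ _ (hne x)]

/-- Time averages of the walk project `ℂ^Ω ⊗ |0⟩` onto the stationary state. -/
theorem tendsto_average_walk {P : Matrix Ω Ω ℝ} (hP : P ∈ Matrix.rowStochastic ℝ Ω)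
    (hprim : P.IsPrimitive) {p : Ω → ℝ} (hp : IsStationary P p) (hrev : IsReversible P p)
    (ψ : Ω → ℂ) :
    Tendsto (fun N : ℕ => l2norm ((N : ℂ)⁻¹ • ∑ n ∈ Finset.range N, (walk P ^ n) *ᵥ embWalk ψ -
      (star (sqrtVec p) ⬝ᵥ ψ) • embWalk (sqrtVec p))) atTop (𝓝 0) := by
  set f := Matrix.toEuclideanCLM (n := Sys Ω) (𝕜 := ℂ) (walk P) with hf
  have hnorm : ‖f‖ ≤ 1 := by
    refine f.opNorm_le_bound zero_le_one fun v => ?_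
    rw [one_mul]
    exact (l2norm_mulVec (walk_mem_unitaryGroup hP) v.ofLp).le
  have hlim := f.tendsto_birkhoffAverage_orthogonalProjection hnorm (WithLp.toLp 2 (embWalk ψ))
  have hproj : ((f.eqLocus (1 : EuclideanSpace ℂ (Sys Ω) →L[ℂ] EuclideanSpace ℂ (Sys Ω))).orthogonalProjectionOnto
      (WithLp.toLp 2 (embWalk ψ)) : EuclideanSpace ℂ (Sys Ω)) =
      WithLp.toLp 2 ((star (sqrtVec p) ⬝ᵥ ψ) • embWalk (sqrtVec p)) := by
    -- The candidate is itself fixed, and its difference from `ψ ⊗ |0⟩` is orthogonal to every fixed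
    -- vector `w`, because `w` is a multiple of `√p` on the states with second register `0`.
    refine Submodule.eq_starProjection_of_mem_of_inner_eq_zero ?_ fun w hw => ?_
    · change f _ = _
      rw [hf, Matrix.toEuclideanCLM_toLp, Matrix.mulVec_smul,
        walk_mulVec_embWalk_sqrtVec hP hp.1.1 hrev]
      rfl
    · have hw' : walk P *ᵥ w.ofLp = w.ofLp := congrArg WithLp.ofLp hw
      obtain ⟨C, hC⟩ := exists_eq_of_walk_fixed hP hprim hp hrev hw'
      rw [← WithLp.toLp_sub, EuclideanSpace.inner_eq_star_dotProduct, dotProduct_comm, star_sub,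
        star_smul, sub_dotProduct, smul_dotProduct, embWalk_dotProduct, embWalk_dotProduct]
      have h1 : ∑ x, star (sqrtVec p x) * w.ofLp (x, none) = C := by
        have h := sqrtVec_dotProduct_self hp.1
        simp only [dotProduct, Pi.star_apply] at h
        simp only [hC, mul_left_comm _ C, ← Finset.mul_sum, h, mul_one]
      have h2 : ∑ x, star (ψ x) * w.ofLp (x, none) = star (star (sqrtVec p) ⬝ᵥ ψ) * C := by
        rw [← Matrix.star_dotProduct]
        simp only [hC, mul_left_comm _ C, ← Finset.mul_sum, dotProduct, Pi.star_apply, mul_comm]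
      rw [h1, h2, smul_eq_mul, sub_self]
  rw [tendsto_iff_norm_sub_tendsto_zero] at hlim
  refine hlim.congr fun N => ?_
  rw [hproj]
  have hiter : ∀ n, f^[n] (WithLp.toLp 2 (embWalk ψ)) =
      WithLp.toLp 2 ((walk P ^ n) *ᵥ embWalk ψ) := by
    intro n
    induction n with
    | zero => simp
    | succ n ih =>
      rw [Function.iterate_succ_apply', ih, hf, Matrix.toEuclideanCLM_toLp, Matrix.mulVec_mulVec,
        pow_succ']
  simp only [birkhoffAverage, birkhoffSum, hiter, l2norm, id]
  simp only [WithLp.toLp_sub, WithLp.toLp_smul, WithLp.toLp_sum]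

end FixedVectors

/-! ### Approximate selective phase shifts -/

section PhaseEstimation

variable {Ω : Type*}

/-- The product vector `s ⊗ f` of the walk registers and the phase registers. -/
def tens {p : Params} (s : Sys Ω → ℂ) (f : Anc p → ℂ) : Sys Ω × Anc p → ℂ :=
  fun i => s i.1 * f i.2

/-- The state `|0,…,0⟩` of the phase registers. -/
def ancZero (p : Params) : Anc p → ℂ := fun n => if ∀ l, (n l : ℕ) = 0 then 1 else 0

/-- The vector `ψ ⊗ |0⟩ ⊗ |0,…,0⟩`. -/
def emb (p : Params) (ψ : Ω → ℂ) : Sys Ω × Anc p → ℂ :=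
  fun i => if i.1.2 = none ∧ ∀ l, (i.2 l : ℕ) = 0 then ψ i.1.1 else 0

theorem emb_eq_tens (p : Params) (ψ : Ω → ℂ) : emb p ψ = tens (embWalk ψ) (ancZero p) := by
  ext i
  by_cases h : i.1.2 = none <;> simp [emb, tens, embWalk, ancZero, h]

theorem emb_add (p : Params) (ψ φ : Ω → ℂ) : emb p (ψ + φ) = emb p ψ + emb p φ := by
  ext i
  simp only [emb, Pi.add_apply]
  split_ifs <;> simp

theorem emb_sub (p : Params) (ψ φ : Ω → ℂ) : emb p (ψ - φ) = emb p ψ - emb p φ := by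
  ext i
  simp only [emb, Pi.sub_apply]
  split_ifs <;> simp

theorem emb_smul (p : Params) (z : ℂ) (ψ : Ω → ℂ) : emb p (z • ψ) = z • emb p ψ := by
  ext i
  simp [emb]

theorem ancZero_eq_single (p : Params) : ancZero p = Pi.single 0 1 := by
  ext n
  simp [ancZero, Pi.single_apply, funext_iff]

/-- The projection onto the states whose phase registers all read `0`. -/
noncomputable def ancProj (Ω : Type*) [DecidableEq Ω] (p : Params) :
    Matrix (Sys Ω × Anc p) (Sys Ω × Anc p) ℂ :=
  Matrix.diagonal fun i => ancZero p i.2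

theorem phaseShift_eq [DecidableEq Ω] (p : Params) : phaseShift Ω p = 1 + (omega - 1) • ancProj Ω p := by
  rw [phaseShift, ancProj, ← Matrix.diagonal_one, ← Matrix.diagonal_smul, Matrix.diagonal_add]
  congr 1
  ext i
  by_cases h : ∀ l, (i.2 l : ℕ) = 0
  · simp only [Pi.smul_apply, ancZero, if_pos h, smul_eq_mul]
    ring
  · simp only [Pi.smul_apply, ancZero, if_neg h, smul_eq_mul, mul_zero, add_zero]

theorem conjTranspose_phaseShift [DecidableEq Ω] (p : Params) :
    (phaseShift Ω p)ᴴ = 1 + (star omega - 1) • ancProj Ω p := by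
  have h : (ancProj Ω p)ᴴ = ancProj Ω p := by
    rw [ancProj, Matrix.diagonal_conjTranspose]
    congr 1
    ext i
    simp [ancZero, apply_ite]
  rw [phaseShift_eq, Matrix.conjTranspose_add, Matrix.conjTranspose_one,
    Matrix.conjTranspose_smul, h, star_sub, star_one]

variable [Fintype Ω]

theorem l2norm_tens_ancZero (p : Params) (s : Sys Ω → ℂ) :
    l2norm (tens s (ancZero p)) = l2norm s := by
  refine (sq_eq_sq₀ (l2norm_nonneg _) (l2norm_nonneg _)).1 ?_
  rw [l2norm_sq, l2norm_sq, ancZero_eq_single, Fintype.sum_prod_type]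
  refine Finset.sum_congr rfl fun i _ => ?_
  rw [Finset.sum_eq_single 0 (by intro n _ hn; simp [tens, hn]) (by simp)]
  simp [tens]

theorem l2norm_emb (p : Params) (ψ : Ω → ℂ) : l2norm (emb p ψ) = l2norm ψ := by
  rw [emb_eq_tens, l2norm_tens_ancZero]
  refine (sq_eq_sq₀ (l2norm_nonneg _) (l2norm_nonneg _)).1 ?_
  simp [l2norm_sq, embWalk, Fintype.sum_prod_type, Fintype.sum_option]

variable [DecidableEq Ω]

theorem one_kronecker_mulVec (p : Params) (A : Matrix (Anc p) (Anc p) ℂ)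
    (v : Sys Ω × Anc p → ℂ) (s : Sys Ω) (n : Anc p) :
    (((1 : Matrix (Sys Ω) (Sys Ω) ℂ) ⊗ₖ A) *ᵥ v) (s, n) = ∑ n', A n n' * v (s, n') := by
  simp only [Matrix.mulVec, dotProduct, Matrix.kroneckerMap_apply, Matrix.one_apply]
  rw [Fintype.sum_prod_type, Finset.sum_eq_single s (by intro z _ hz; simp [hz.symm]) (by simp)]
  simp

theorem one_kronecker_mulVec_tens (p : Params) (A : Matrix (Anc p) (Anc p) ℂ) (s : Sys Ω → ℂ)
    (f : Anc p → ℂ) :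
    ((1 : Matrix (Sys Ω) (Sys Ω) ℂ) ⊗ₖ A) *ᵥ tens s f = tens s (A *ᵥ f) := by
  ext ⟨i, n⟩
  rw [one_kronecker_mulVec]
  simp [tens, Matrix.mulVec, dotProduct, Finset.mul_sum, mul_left_comm]

theorem controlledWalk_mulVec_tens (p : Params) (P : Matrix Ω Ω ℝ) (s : Sys Ω → ℂ)
    (f : Anc p → ℂ) (i : Sys Ω) (n : Anc p) :
    (controlledWalk p P *ᵥ tens s f) (i, n) = ((walk P ^ (∑ l, (n l : ℕ))) *ᵥ s) i * f n := by
  simp only [controlledWalk, Matrix.mulVec, dotProduct, Matrix.of_apply, tens, ite_mul, zero_mul,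
    Finset.sum_mul]
  rw [Fintype.sum_prod_type]
  refine Finset.sum_congr rfl fun j _ => ?_
  rw [Finset.sum_eq_single n (by intro z _ hz; simp [hz.symm]) (by simp)]
  simp [mul_assoc]

/-- Phase estimation does not move a fixed vector of the walk. -/
theorem phaseEstimation_mulVec_of_fixed (p : Params) {P : Matrix Ω Ω ℝ} {s : Sys Ω → ℂ}
    (hs : walk P *ᵥ s = s) (f : Anc p → ℂ) :
    phaseEstimation p P *ᵥ tens s f = tens s f := by
  have hpow : ∀ n : ℕ, (walk P ^ n) *ᵥ s = s := fun n => by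
    induction n with
    | zero => simp
    | succ n ih => rw [pow_succ, ← Matrix.mulVec_mulVec, hs, ih]
  have hCW : ∀ f : Anc p → ℂ, controlledWalk p P *ᵥ tens s f = tens s f := fun f => by
    ext ⟨i, n⟩
    rw [controlledWalk_mulVec_tens, hpow, tens]
  have hF : (qftAll p)ᴴ * qftAll p = 1 :=
    Matrix.mem_unitaryGroup_iff'.1 (qftAll_mem_unitaryGroup p)
  rw [phaseEstimation, ← Matrix.mulVec_mulVec, ← Matrix.mulVec_mulVec, one_kronecker_mulVec_tens,
    hCW, one_kronecker_mulVec_tens, Matrix.mulVec_mulVec, hF, Matrix.one_mulVec]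

/-- The transform of the zero state is uniform; this is what makes the average over walk powers
unweighted. -/
theorem qftAll_apply_zero (p : Params) (n : Anc p) :
    qftAll p n 0 = (((√(2 ^ p.t))⁻¹ ^ p.k : ℝ) : ℂ) := by
  simp [qftAll, qft]

/-- The component of the estimated state with phase registers `0` is a time average of the
walk. -/
theorem ancProj_mulVec_phaseEstimation (p : Params) (P : Matrix Ω Ω ℝ) (s : Sys Ω → ℂ) :
    ancProj Ω p *ᵥ (phaseEstimation p P *ᵥ tens s (ancZero p)) =
      tens (((2 ^ p.t : ℂ) ^ p.k)⁻¹ • ∑ n : Anc p, (walk P ^ (∑ l, (n l : ℕ))) *ᵥ s)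
        (ancZero p) := by
  have hr : (((√(2 ^ p.t))⁻¹ ^ p.k : ℝ) : ℂ) * (((√(2 ^ p.t))⁻¹ ^ p.k : ℝ) : ℂ) =
      ((2 ^ p.t : ℂ) ^ p.k)⁻¹ := by
    rw [← Complex.ofReal_mul, ← mul_pow, ← mul_inv, Real.mul_self_sqrt (by positivity)]
    simp
  ext ⟨i, n⟩
  rw [ancProj, Matrix.mulVec_diagonal, tens, mul_comm, ancZero_eq_single]
  by_cases hn : n = 0
  · subst hn
    congr 1
    rw [phaseEstimation, ← Matrix.mulVec_mulVec, ← Matrix.mulVec_mulVec,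
      one_kronecker_mulVec_tens, one_kronecker_mulVec]
    simp only [controlledWalk_mulVec_tens, Matrix.conjTranspose_apply, Matrix.mulVec_single_one,
      Matrix.col_apply, qftAll_apply_zero, Pi.smul_apply, Finset.sum_apply, smul_eq_mul,
      Finset.mul_sum, Complex.star_def, Complex.conj_ofReal]
    refine Finset.sum_congr rfl fun n _ => ?_
    rw [← hr]
    ring
  · simp [hn]

end PhaseEstimation

/-! ### The ideal amplification -/

section Ideal

variable {Ω : Type*} [DecidableEq Ω]

/-- The exact phase shift by `z` of the unit vector `u`. -/
def gate (z : ℂ) (u : Ω → ℂ) : Matrix Ω Ω ℂ := 1 + (z - 1) • Matrix.vecMulVec u (star u)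

theorem conjTranspose_gate (z : ℂ) (u : Ω → ℂ) : (gate z u)ᴴ = gate (star z) u := by
  simp [gate, Matrix.conjTranspose_vecMulVec]

variable [Fintype Ω]

/-- Exact `π/3`-amplitude amplification from `u` to `u'`. -/
noncomputable def idealAmplify (u u' : Ω → ℂ) : ℕ → Matrix Ω Ω ℂ
  | 0 => 1
  | m + 1 => idealAmplify u u' m * gate omega u * (idealAmplify u u' m)ᴴ *
      gate omega u' * idealAmplify u u' m

/-- The state reached after `i` stages of exact amplification. -/
noncomputable def idealState (m : ℕ) (u : ℕ → Ω → ℂ) : ℕ → Ω → ℂ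
  | 0 => u 0
  | i + 1 => idealAmplify (u i) (u (i + 1)) m *ᵥ idealState m u i

theorem gate_mulVec (z : ℂ) (u v : Ω → ℂ) :
    gate z u *ᵥ v = v + ((z - 1) * (star u ⬝ᵥ v)) • u := by
  simp [gate, Matrix.add_mulVec, Matrix.smul_mulVec, Matrix.vecMulVec_mulVec, smul_smul]

theorem gate_omega_mem_unitaryGroup {u : Ω → ℂ} (hu : star u ⬝ᵥ u = 1) :
    gate omega u ∈ Matrix.unitaryGroup Ω ℂ := by
  rw [Matrix.mem_unitaryGroup_iff, Matrix.star_eq_conjTranspose, conjTranspose_gate]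
  refine Matrix.ext_of_mulVec_single fun i => ?_
  generalize (Pi.single i 1 : Ω → ℂ) = v
  rw [← Matrix.mulVec_mulVec, gate_mulVec, gate_mulVec, dotProduct_add, dotProduct_smul, hu,
    Matrix.one_mulVec, add_assoc, ← add_smul]
  have h : (star omega - 1) * (star u ⬝ᵥ v) +
      (omega - 1) * (star u ⬝ᵥ v + ((star omega - 1) * (star u ⬝ᵥ v)) • 1) = 0 := by
    rw [smul_eq_mul]
    linear_combination (star u ⬝ᵥ v) * omega_mul_star
  rw [h, zero_smul, add_zero]

theorem idealAmplify_mem_unitaryGroup {u u' : Ω → ℂ} (hu : star u ⬝ᵥ u = 1)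
    (hu' : star u' ⬝ᵥ u' = 1) (m : ℕ) : idealAmplify u u' m ∈ Matrix.unitaryGroup Ω ℂ := by
  induction m with
  | zero => exact one_mem _
  | succ m ih =>
    exact mul_mem (mul_mem (mul_mem (mul_mem ih (gate_omega_mem_unitaryGroup hu))
      (conjTranspose_mem_unitaryGroup ih)) (gate_omega_mem_unitaryGroup hu')) ih

end Ideal

/-! ### Convergence of the algorithm to the ideal amplification -/

section Implements

variable {Ω : Type*} [Fintype Ω] [DecidableEq Ω]

/-- The unitaries `M t` act on the states `ψ ⊗ |0⟩ ⊗ |0,…,0⟩` like `A`, in the limit. -/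
def Implements (p : ℕ → Params) (M : ∀ t, Matrix (Sys Ω × Anc (p t)) (Sys Ω × Anc (p t)) ℂ)
    (A : Matrix Ω Ω ℂ) : Prop :=
  (∀ t, M t ∈ Matrix.unitaryGroup (Sys Ω × Anc (p t)) ℂ) ∧
  ∀ ψ : Ω → ℂ, Tendsto (fun t => l2norm (M t *ᵥ emb (p t) ψ - emb (p t) (A *ᵥ ψ))) atTop (𝓝 0)

/-- Being unitary, `M t` does not enlarge the error already present in its input. -/
theorem Implements.tendsto_mulVec {p : ℕ → Params}
    {M : ∀ t, Matrix (Sys Ω × Anc (p t)) (Sys Ω × Anc (p t)) ℂ} {A : Matrix Ω Ω ℂ}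
    (hM : Implements p M A) {v : ∀ t, Sys Ω × Anc (p t) → ℂ} {ψ : Ω → ℂ}
    (hv : Tendsto (fun t => l2norm (v t - emb (p t) ψ)) atTop (𝓝 0)) :
    Tendsto (fun t => l2norm (M t *ᵥ v t - emb (p t) (A *ᵥ ψ))) atTop (𝓝 0) := by
  refine squeeze_zero (fun t => l2norm_nonneg _) (fun t => ?_)
    (by simpa using hv.add (hM.2 ψ))
  refine (l2norm_sub_le_add _ (M t *ᵥ emb (p t) ψ) _).trans (add_le_add_left ?_ _)
  rw [← Matrix.mulVec_sub, l2norm_mulVec (hM.1 t)]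

theorem Implements.mul {p : ℕ → Params}
    {M N : ∀ t, Matrix (Sys Ω × Anc (p t)) (Sys Ω × Anc (p t)) ℂ} {A B : Matrix Ω Ω ℂ}
    (hM : Implements p M A) (hN : Implements p N B) :
    Implements p (fun t => M t * N t) (A * B) := by
  refine ⟨fun t => mul_mem (hM.1 t) (hN.1 t), fun ψ => ?_⟩
  simpa only [Matrix.mulVec_mulVec] using hM.tendsto_mulVec (hN.2 ψ)

theorem Implements.one (p : ℕ → Params) :
    Implements p (fun _ => 1) (1 : Matrix Ω Ω ℂ) :=
  ⟨fun _ => one_mem _, fun ψ => by simp [l2norm]⟩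

variable {P P' : Matrix Ω Ω ℝ} {π π' : Ω → ℝ}

/-- Phase estimation fixes the stationary state, so the error is exactly `‖z - 1‖` times that of the
time average over `2 ^ t` steps. A general `z` serves both the phase shift and its adjoint. -/
theorem tendsto_phaseEstimation_gate (m : ℕ) (z : ℂ) (hP : P ∈ Matrix.rowStochastic ℝ Ω)
    (hprim : P.IsPrimitive) (hπ : IsStationary P π) (hrev : IsReversible P π) (ψ : Ω → ℂ) :
    Tendsto (fun t => l2norm (((phaseEstimation ⟨t, 1, m⟩ P)ᴴ * (1 + (z - 1) • ancProj Ω _) *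
      phaseEstimation ⟨t, 1, m⟩ P) *ᵥ emb ⟨t, 1, m⟩ ψ -
        emb ⟨t, 1, m⟩ (gate z (sqrtVec π) *ᵥ ψ))) atTop (𝓝 0) := by
  have hlim := ((tendsto_average_walk hP hprim hπ hrev ψ).comp
    (tendsto_pow_atTop_atTop_of_one_lt (one_lt_two (α := ℕ)))).const_mul ‖z - 1‖
  rw [mul_zero] at hlim
  refine hlim.congr fun t => ?_
  set p : Params := ⟨t, 1, m⟩
  set F := phaseEstimation p P with hF
  have hFu : F ∈ Matrix.unitaryGroup (Sys Ω × Anc p) ℂ := phaseEstimation_mem_unitaryGroup p hP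
  have hFF : Fᴴ * F = 1 := Matrix.mem_unitaryGroup_iff'.1 hFu
  have hsum : ((2 ^ p.t : ℂ) ^ p.k)⁻¹ •
      ∑ n : Anc p, (walk P ^ (∑ l, (n l : ℕ))) *ᵥ embWalk ψ =
      ((2 ^ t : ℕ) : ℂ)⁻¹ • ∑ n ∈ Finset.range (2 ^ t), (walk P ^ n) *ᵥ embWalk ψ := by
    rw [← Fin.sum_univ_eq_sum_range (fun n => (walk P ^ n) *ᵥ embWalk ψ),
      ← (Equiv.funUnique (Fin 1) (Fin (2 ^ t))).sum_comp]
    simp [p]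
  have hstat : Fᴴ *ᵥ tens (embWalk (sqrtVec π)) (ancZero p) = emb p (sqrtVec π) := by
    conv_lhs => rw [← phaseEstimation_mulVec_of_fixed p
      (walk_mulVec_embWalk_sqrtVec hP hπ.1.1 hrev) (ancZero p)]
    rw [← hF, Matrix.mulVec_mulVec, hFF, Matrix.one_mulVec, emb_eq_tens]
  set a := ((2 ^ t : ℕ) : ℂ)⁻¹ • ∑ n ∈ Finset.range (2 ^ t), (walk P ^ n) *ᵥ embWalk ψ with ha
  have hmain : (Fᴴ * (1 + (z - 1) • ancProj Ω p) * F) *ᵥ emb p ψ =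
      emb p ψ + (z - 1) • Fᴴ *ᵥ tens a (ancZero p) := by
    rw [← Matrix.mulVec_mulVec, ← Matrix.mulVec_mulVec, Matrix.add_mulVec, Matrix.one_mulVec,
      Matrix.smul_mulVec, emb_eq_tens, ancProj_mulVec_phaseEstimation, hsum, Matrix.mulVec_add,
      Matrix.mulVec_mulVec, hFF, Matrix.one_mulVec, Matrix.mulVec_smul]
  have hdiff : (Fᴴ * (1 + (z - 1) • ancProj Ω p) * F) *ᵥ emb p ψ -
      emb p (gate z (sqrtVec π) *ᵥ ψ) = (z - 1) • Fᴴ *ᵥ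
        tens (a - (star (sqrtVec π) ⬝ᵥ ψ) • embWalk (sqrtVec π)) (ancZero p) := by
    have htens : tens (a - (star (sqrtVec π) ⬝ᵥ ψ) • embWalk (sqrtVec π)) (ancZero p) =
        tens a (ancZero p) -
          (star (sqrtVec π) ⬝ᵥ ψ) • tens (embWalk (sqrtVec π)) (ancZero p) := by
      ext i
      simp [tens, sub_mul, mul_assoc]
    rw [hmain, gate_mulVec, emb_add, emb_smul, htens, Matrix.mulVec_sub, Matrix.mulVec_smul, hstat,
      smul_sub, smul_smul]
    abel
  rw [hdiff, l2norm_smul, l2norm_mulVec (conjTranspose_mem_unitaryGroup hFu),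
    l2norm_tens_ancZero]
  rfl

theorem implements_selectivePhase (m : ℕ) (hP : P ∈ Matrix.rowStochastic ℝ Ω)
    (hprim : P.IsPrimitive) (hπ : IsStationary P π) (hrev : IsReversible P π) :
    Implements (fun t => ⟨t, 1, m⟩) (fun t => selectivePhase ⟨t, 1, m⟩ P)
      (gate omega (sqrtVec π)) := by
  refine ⟨fun t => selectivePhase_mem_unitaryGroup _ hP, fun ψ => ?_⟩
  simpa only [selectivePhase, phaseShift_eq] using
    tendsto_phaseEstimation_gate m omega hP hprim hπ hrev ψ

theorem implements_conjTranspose_selectivePhase (m : ℕ) (hP : P ∈ Matrix.rowStochastic ℝ Ω)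
    (hprim : P.IsPrimitive) (hπ : IsStationary P π) (hrev : IsReversible P π) :
    Implements (fun t => ⟨t, 1, m⟩) (fun t => (selectivePhase ⟨t, 1, m⟩ P)ᴴ)
      (gate omega (sqrtVec π))ᴴ := by
  refine ⟨fun t => conjTranspose_mem_unitaryGroup (selectivePhase_mem_unitaryGroup _ hP),
    fun ψ => ?_⟩
  simpa only [selectivePhase, Matrix.conjTranspose_mul, Matrix.conjTranspose_conjTranspose,
    conjTranspose_phaseShift, conjTranspose_gate, mul_assoc] using
    tendsto_phaseEstimation_gate m (star omega) hP hprim hπ hrev ψ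

/-- The recursion contains `V_j†`, so the induction must carry the adjoint along. -/
theorem implements_amplify (m j : ℕ) (hP : P ∈ Matrix.rowStochastic ℝ Ω)
    (hprim : P.IsPrimitive) (hπ : IsStationary P π) (hrev : IsReversible P π)
    (hP' : P' ∈ Matrix.rowStochastic ℝ Ω) (hprim' : P'.IsPrimitive) (hπ' : IsStationary P' π')
    (hrev' : IsReversible P' π') :
    Implements (fun t => ⟨t, 1, m⟩) (fun t => amplify ⟨t, 1, m⟩ P P' j)
      (idealAmplify (sqrtVec π) (sqrtVec π') j) ∧
    Implements (fun t => ⟨t, 1, m⟩) (fun t => (amplify ⟨t, 1, m⟩ P P' j)ᴴ)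
      (idealAmplify (sqrtVec π) (sqrtVec π') j)ᴴ := by
  have hR := implements_selectivePhase m hP hprim hπ hrev
  have hR' := implements_selectivePhase m hP' hprim' hπ' hrev'
  have hS := implements_conjTranspose_selectivePhase m hP hprim hπ hrev
  have hS' := implements_conjTranspose_selectivePhase m hP' hprim' hπ' hrev'
  induction j with
  | zero => simpa [amplify, idealAmplify] using Implements.one (Ω := Ω) (fun t => ⟨t, 1, m⟩)
  | succ j ih =>
    refine ⟨(((ih.1.mul hR).mul ih.2).mul hR').mul ih.1, ?_⟩
    simpa only [amplify, idealAmplify, Matrix.conjTranspose_mul,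
      Matrix.conjTranspose_conjTranspose] using ih.2.mul (hS'.mul (ih.1.mul (hS.mul ih.2)))

theorem tendsto_preparedState {r : ℕ} {Qs : ℕ → Matrix Ω Ω ℝ} {π : ℕ → Ω → ℝ}
    (hQs : ∀ i ≤ r, Qs i ∈ Matrix.rowStochastic ℝ Ω) (herg : ∀ i ≤ r, (Qs i).IsPrimitive)
    (hπ : ∀ i ≤ r, IsStationary (Qs i) (π i)) (hrev : ∀ i ≤ r, IsReversible (Qs i) (π i))
    (m i : ℕ) (hi : i ≤ r) :
    Tendsto (fun t => l2norm (preparedState ⟨t, 1, m⟩ Qs (π 0) i -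
      emb ⟨t, 1, m⟩ (idealState m (fun j => sqrtVec (π j)) i))) atTop (𝓝 0) := by
  induction i with
  | zero =>
    have h : ∀ t, preparedState ⟨t, 1, m⟩ Qs (π 0) 0 =
        emb ⟨t, 1, m⟩ (idealState m (fun j => sqrtVec (π j)) 0) := fun t => rfl
    simp [h, l2norm]
  | succ i ih =>
    have hi' : i ≤ r := (Nat.le_succ i).trans hi
    exact (implements_amplify m m (hQs i hi') (herg i hi') (hπ i hi') (hrev i hi')
      (hQs _ hi) (herg _ hi) (hπ _ hi) (hrev _ hi)).1.tendsto_mulVec (ih hi')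

end Implements

/-! ### Convergence of the ideal amplification -/

section Grover

theorem omega_eq : omega = 1 / 2 + (√3 / 2 : ℝ) * Complex.I := by
  rw [omega, show Complex.I * Real.pi / 3 = ((Real.pi / 3 : ℝ) : ℂ) * Complex.I by
    push_cast; ring, Complex.exp_mul_I, ← Complex.ofReal_cos, ← Complex.ofReal_sin,
    Real.cos_pi_div_three, Real.sin_pi_div_three]
  push_cast
  ring

/-- Here `ω - 1 = ω²`, a unit vector at angle `π/3` to `ω`; the cross term is `2 cos(π/3) δ = δ`.
This is where the choice of angle matters. -/
theorem norm_sq_omega_sub_one_add (δ : ℝ) : ‖omega - 1 + omega * δ‖ ^ 2 = 1 + δ + δ ^ 2 := by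
  have h3 : √3 * √3 = 3 := Real.mul_self_sqrt (by norm_num)
  rw [Complex.sq_norm, Complex.normSq_apply, omega_eq]
  simp
  linear_combination ((1 + δ) ^ 2 / 4) * h3

theorem omega_sq : omega ^ 2 = omega - 1 := by
  have h3 : ((√3 : ℝ) : ℂ) * (√3 : ℝ) = 3 := by
    rw [← Complex.ofReal_mul, Real.mul_self_sqrt (by norm_num)]
    norm_num
  rw [omega_eq]
  push_cast
  linear_combination (-1 / 4 : ℂ) * h3 + (((√3 : ℝ) : ℂ) ^ 2 / 4) * Complex.I_sq

variable {Ω : Type*} [Fintype Ω]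

theorem l2norm_eq_one {v : Ω → ℂ} (hv : star v ⬝ᵥ v = 1) : l2norm v = 1 := by
  have h := l2norm_sq_eq_dotProduct v
  rw [hv] at h
  have h' : l2norm v ^ 2 = 1 := by exact_mod_cast h
  exact (pow_eq_one_iff_of_nonneg (l2norm_nonneg v) two_ne_zero).1 h'

/-- Pythagoras: the failure probability is the squared distance to the line spanned by the target.
-/
theorem l2norm_sub_smul_sq {v w : Ω → ℂ} (hv : star v ⬝ᵥ v = 1) (hw : star w ⬝ᵥ w = 1) :
    l2norm (v - (star w ⬝ᵥ v) • w) ^ 2 = 1 - ‖star w ⬝ᵥ v‖ ^ 2 := by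
  have h1 : star v ⬝ᵥ w = star (star w ⬝ᵥ v) := Matrix.star_dotProduct _ _
  have h2 := Complex.mul_conj' (star w ⬝ᵥ v)
  rw [← Complex.star_def] at h2
  apply Complex.ofReal_injective
  rw [l2norm_sq_eq_dotProduct, star_sub, star_smul, sub_dotProduct, dotProduct_sub,
    dotProduct_sub, smul_dotProduct, smul_dotProduct, dotProduct_smul, dotProduct_smul, hv, hw, h1]
  push_cast
  simp only [smul_eq_mul]
  linear_combination -h2

theorem norm_dotProduct_le_one {v w : Ω → ℂ} (hv : star v ⬝ᵥ v = 1) (hw : star w ⬝ᵥ w = 1) :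
    ‖star w ⬝ᵥ v‖ ≤ 1 := by
  have h := l2norm_sub_smul_sq hv hw
  have := sq_nonneg (l2norm (v - (star w ⬝ᵥ v) • w))
  exact (sq_le_one_iff₀ (norm_nonneg _)).1 (by linarith)

variable [DecidableEq Ω]

/-- Each level of amplification cubes the failure probability. -/
theorem one_sub_norm_sq_idealAmplify_succ {u u' : Ω → ℂ} (hu : star u ⬝ᵥ u = 1)
    (hu' : star u' ⬝ᵥ u' = 1) (m : ℕ) :
    1 - ‖star u' ⬝ᵥ (idealAmplify u u' (m + 1) *ᵥ u)‖ ^ 2 =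
      (1 - ‖star u' ⬝ᵥ (idealAmplify u u' m *ᵥ u)‖ ^ 2) ^ 3 := by
  have hV := idealAmplify_mem_unitaryGroup hu hu' m
  set V := idealAmplify u u' m with hVdef
  set w := V *ᵥ u with hw
  set β := star u' ⬝ᵥ w with hβ
  have hww : star w ⬝ᵥ w = 1 := by rw [hw, star_mulVec_dotProduct_mulVec hV, hu]
  have hVV : V * Vᴴ = 1 := Matrix.mem_unitaryGroup_iff.1 hV
  -- Conjugation by `V` turns the phase shift of `u` into that of `w = V u`, so the next level acts
  -- in the span of `w` and `u'`.
  have hconj : ∀ y, V *ᵥ (gate omega u *ᵥ (Vᴴ *ᵥ y)) = gate omega w *ᵥ y := by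
    intro y
    have : star u ⬝ᵥ (Vᴴ *ᵥ y) = star w ⬝ᵥ y := by
      rw [hw, Matrix.star_mulVec, Matrix.dotProduct_mulVec]
    rw [gate_mulVec, gate_mulVec, Matrix.mulVec_add, Matrix.mulVec_mulVec, hVV, Matrix.one_mulVec,
      Matrix.mulVec_smul, this, ← hw]
  have hstep : star u' ⬝ᵥ (idealAmplify u u' (m + 1) *ᵥ u) =
      β * (omega - 1 + omega * ((1 - ‖β‖ ^ 2 : ℝ) : ℂ)) := by
    have h1 : star w ⬝ᵥ u' = star β := Matrix.star_dotProduct _ _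
    have h2 := Complex.mul_conj' β
    rw [← Complex.star_def] at h2
    rw [idealAmplify, ← hVdef, ← Matrix.mulVec_mulVec, ← Matrix.mulVec_mulVec,
      ← Matrix.mulVec_mulVec, ← Matrix.mulVec_mulVec, ← hw, hconj, gate_mulVec, gate_mulVec]
    simp only [dotProduct_add, dotProduct_smul, hww, h1, hu', ← hβ, smul_eq_mul]
    push_cast
    linear_combination (β * (omega - 1) ^ 2) * h2 + (β * (‖β‖ : ℂ) ^ 2) * omega_sq
  -- With `δ = 1 - ‖β‖²`, the success probability is `(1 - δ)(1 + δ + δ²) = 1 - δ³`.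
  rw [hstep, norm_mul, mul_pow, norm_sq_omega_sub_one_add]
  ring

theorem one_sub_norm_sq_idealAmplify {u u' : Ω → ℂ} (hu : star u ⬝ᵥ u = 1)
    (hu' : star u' ⬝ᵥ u' = 1) (m : ℕ) :
    1 - ‖star u' ⬝ᵥ (idealAmplify u u' m *ᵥ u)‖ ^ 2 = (1 - ‖star u' ⬝ᵥ u‖ ^ 2) ^ 3 ^ m := by
  induction m with
  | zero => simp [idealAmplify]
  | succ m ih => rw [one_sub_norm_sq_idealAmplify_succ hu hu', ih, ← pow_mul, ← pow_succ]

theorem tendsto_idealAmplify {u u' : Ω → ℂ} (hu : star u ⬝ᵥ u = 1) (hu' : star u' ⬝ᵥ u' = 1)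
    (h : 0 < ‖star u' ⬝ᵥ u‖) :
    Tendsto (fun m => l2norm (idealAmplify u u' m *ᵥ u -
      (star u' ⬝ᵥ (idealAmplify u u' m *ᵥ u)) • u')) atTop (𝓝 0) := by
  have hle := norm_dotProduct_le_one hu hu'
  have hpow : Tendsto (fun m : ℕ => (1 - ‖star u' ⬝ᵥ u‖ ^ 2) ^ 3 ^ m) atTop (𝓝 0) :=
    (tendsto_pow_atTop_nhds_zero_of_lt_one (by nlinarith) (by nlinarith)).comp
      (tendsto_pow_atTop_atTop_of_one_lt (by norm_num))
  have hsqrt := (Real.continuous_sqrt.tendsto 0).comp hpow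
  rw [Real.sqrt_zero] at hsqrt
  refine hsqrt.congr fun m => ?_
  have hw : star (idealAmplify u u' m *ᵥ u) ⬝ᵥ (idealAmplify u u' m *ᵥ u) = 1 := by
    rw [star_mulVec_dotProduct_mulVec (idealAmplify_mem_unitaryGroup hu hu' m), hu]
  rw [Function.comp_apply, ← one_sub_norm_sq_idealAmplify hu hu', ← l2norm_sub_smul_sq hw hu',
    Real.sqrt_sq (l2norm_nonneg _)]

/-- The scalar `z m` is the product of the overlaps reached in the successive stages. Allowing
modulus at most one, rather than exactly one, avoids normalising it. -/
theorem exists_tendsto_idealState {u : ℕ → Ω → ℂ} {r : ℕ}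
    (hu : ∀ i ≤ r, star (u i) ⬝ᵥ u i = 1) (h : ∀ i < r, 0 < ‖star (u (i + 1)) ⬝ᵥ u i‖)
    (i : ℕ) (hi : i ≤ r) :
    ∃ z : ℕ → ℂ, (∀ m, ‖z m‖ ≤ 1) ∧
      Tendsto (fun m => l2norm (idealState m u i - z m • u i)) atTop (𝓝 0) := by
  induction i with
  | zero => exact ⟨fun _ => 1, by simp, by simp [idealState, l2norm]⟩
  | succ i ih =>
    have hi' : i ≤ r := (Nat.le_succ i).trans hi
    obtain ⟨z, hz, hlim⟩ := ih hi'
    have hV := idealAmplify_mem_unitaryGroup (hu i hi') (hu (i + 1) hi)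
    have hamp := tendsto_idealAmplify (hu i hi') (hu (i + 1) hi) (h i hi)
    have hβ : ∀ m, ‖star (u (i + 1)) ⬝ᵥ (idealAmplify (u i) (u (i + 1)) m *ᵥ u i)‖ ≤ 1 :=
      fun m => norm_dotProduct_le_one
        (by rw [star_mulVec_dotProduct_mulVec (hV m), hu i hi']) (hu (i + 1) hi)
    refine ⟨fun m => z m * (star (u (i + 1)) ⬝ᵥ (idealAmplify (u i) (u (i + 1)) m *ᵥ u i)),
      fun m => ?_, ?_⟩
    · rw [norm_mul]
      exact mul_le_one₀ (hz m) (norm_nonneg _) (hβ m)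
    · refine squeeze_zero (fun m => l2norm_nonneg _) (fun m => ?_)
        (by simpa using hlim.add hamp)
      rw [idealState]
      refine (l2norm_sub_le_add _ (idealAmplify (u i) (u (i + 1)) m *ᵥ (z m • u i)) _).trans
        (add_le_add ?_ ?_)
      · rw [← Matrix.mulVec_sub, l2norm_mulVec (hV m)]
      · rw [Matrix.mulVec_smul, ← smul_smul, ← smul_sub, l2norm_smul]
        exact mul_le_of_le_one_left (l2norm_nonneg _) (hz m)

end Grover

/-! ### From states to samples -/

section Sample

/-- Factor `a² - b² = (a - b)(a + b)` and apply Cauchy–Schwarz to each summand. -/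
theorem sum_abs_norm_sq_sub_le {ι : Type*} [Fintype ι] (v w : ι → ℂ) :
    ∑ i, |‖v i‖ ^ 2 - ‖w i‖ ^ 2| ≤ l2norm (v - w) * (l2norm v + l2norm w) := by
  have hl2 : ∀ v : ι → ℂ, √(∑ i, ‖v i‖ ^ 2) = l2norm v := fun v => by
    rw [← l2norm_sq, Real.sqrt_sq (l2norm_nonneg _)]
  have hcs : ∀ u : ι → ℂ, ∑ i, ‖(v - w) i‖ * ‖u i‖ ≤ l2norm (v - w) * l2norm u := fun u => by
    simpa only [hl2] using Real.sum_mul_le_sqrt_mul_sqrt Finset.univ (fun i => ‖(v - w) i‖)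
      (fun i => ‖u i‖)
  calc ∑ i, |‖v i‖ ^ 2 - ‖w i‖ ^ 2|
      ≤ ∑ i, (‖(v - w) i‖ * ‖v i‖ + ‖(v - w) i‖ * ‖w i‖) := by
        refine Finset.sum_le_sum fun i _ => ?_
        rw [sq_sub_sq, abs_mul, abs_of_nonneg (by positivity), mul_comm, ← mul_add]
        exact mul_le_mul_of_nonneg_right (abs_norm_sub_norm_le _ _) (by positivity)
    _ ≤ l2norm (v - w) * (l2norm v + l2norm w) := by
        rw [Finset.sum_add_distrib, mul_add]
        exact add_le_add (hcs v) (hcs w)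

variable {Ω : Type*} [Fintype Ω]

theorem sqrtVec_dotProduct_sqrtVec (p q : Ω → ℝ) :
    star (sqrtVec q) ⬝ᵥ sqrtVec p = (overlap p q : ℝ) := by
  rw [star_sqrtVec]
  simp [dotProduct, sqrtVec, overlap, mul_comm]

theorem sum_norm_sq_emb (p : Params) {π : Ω → ℝ} (hπ : ∀ x, 0 ≤ π x) (x : Ω) :
    ∑ a : Option Ω, ∑ n : Anc p, ‖emb p (sqrtVec π) ((x, a), n)‖ ^ 2 = π x := by
  rw [Fintype.sum_option, emb_eq_tens, ancZero_eq_single]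
  simp only [tens, embWalk]
  rw [Finset.sum_eq_single 0 (by intro n _ hn; simp [hn]) (by simp)]
  simp [sqrtVec, Real.sq_sqrt (hπ x)]

/-- Measuring a state close to the coherent state of `π`, up to a scalar, yields a sample whose
distribution is close to `π`. -/
theorem tv_measure_le (p : Params) {π : Ω → ℝ} (hπ : π ∈ stdSimplex ℝ Ω)
    {v : Sys Ω × Anc p → ℂ} (hv : l2norm v = 1) {z : ℂ} (hz : ‖z‖ ≤ 1) :
    tv (fun x => ∑ a : Option Ω, ∑ n : Anc p, ‖v ((x, a), n)‖ ^ 2) π ≤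
      2 * l2norm (v - z • emb p (sqrtVec π)) := by
  set w := z • emb p (sqrtVec π) with hw
  have hw1 : l2norm w = ‖z‖ := by
    rw [hw, l2norm_smul, l2norm_emb, l2norm_eq_one (sqrtVec_dotProduct_self hπ), mul_one]
  have hwx : ∀ x, ∑ a : Option Ω, ∑ n : Anc p, ‖w ((x, a), n)‖ ^ 2 = ‖z‖ ^ 2 * π x := fun x => by
    rw [← sum_norm_sq_emb p hπ.1 x]
    simp only [hw, Pi.smul_apply, norm_smul, mul_pow, ← Finset.mul_sum]
  have hsum := sum_abs_norm_sq_sub_le v w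
  have hdiff := (abs_le.1 (abs_l2norm_sub_le v w)).2
  have hε := l2norm_nonneg (v - w)
  rw [hv, hw1] at hsum hdiff
  -- The vector `w` has total weight only `‖z‖²`; the last term accounts for the missing mass.
  have hpt : ∀ x, |∑ a : Option Ω, ∑ n : Anc p, ‖v ((x, a), n)‖ ^ 2 - π x| ≤
      ∑ a : Option Ω, ∑ n : Anc p, |‖v ((x, a), n)‖ ^ 2 - ‖w ((x, a), n)‖ ^ 2| +
        (1 - ‖z‖ ^ 2) * π x := by
    intro x
    have h0 : 0 ≤ (1 - ‖z‖ ^ 2) * π x :=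
      mul_nonneg (by nlinarith [norm_nonneg z]) (hπ.1 x)
    have h1 : |∑ a : Option Ω, ∑ n : Anc p, (‖v ((x, a), n)‖ ^ 2 - ‖w ((x, a), n)‖ ^ 2)| ≤
        ∑ a : Option Ω, ∑ n : Anc p, |‖v ((x, a), n)‖ ^ 2 - ‖w ((x, a), n)‖ ^ 2| :=
      (Finset.abs_sum_le_sum_abs _ _).trans
        (Finset.sum_le_sum fun a _ => Finset.abs_sum_le_sum_abs _ _)
    simp only [Finset.sum_sub_distrib, hwx] at h1
    calc _ = |(∑ a : Option Ω, ∑ n : Anc p, ‖v ((x, a), n)‖ ^ 2 - ‖z‖ ^ 2 * π x) -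
          (1 - ‖z‖ ^ 2) * π x| := by congr 1; ring
      _ ≤ _ := (abs_sub _ _).trans (add_le_add h1 (abs_of_nonneg h0).le)
  have htot := Finset.sum_le_sum fun x (_ : x ∈ Finset.univ) => hpt x
  rw [Finset.sum_add_distrib, ← Finset.mul_sum, hπ.2, mul_one] at htot
  rw [Fintype.sum_prod_type, Fintype.sum_prod_type] at hsum
  rw [tv]
  -- With `ε = l2norm (v - w)` and `1 - ‖z‖ ≤ ε`, half of `ε (1 + ‖z‖) + (1 - ‖z‖²)` is at most `ε
  -- (1 + ‖z‖) ≤ 2ε`.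
  nlinarith [norm_nonneg z]

variable [DecidableEq Ω]

theorem l2norm_preparedState {r : ℕ} (p : Params) {Qs : ℕ → Matrix Ω Ω ℝ}
    (hQs : ∀ i ≤ r, Qs i ∈ Matrix.rowStochastic ℝ Ω) {π₀ : Ω → ℝ} (hπ₀ : π₀ ∈ stdSimplex ℝ Ω)
    (i : ℕ) (hi : i ≤ r) : l2norm (preparedState p Qs π₀ i) = 1 := by
  induction i with
  | zero => exact (l2norm_emb p (sqrtVec π₀)).trans (l2norm_eq_one (sqrtVec_dotProduct_self hπ₀))
  | succ i ih =>
    have hi' : i ≤ r := (Nat.le_succ i).trans hi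
    rw [preparedState, l2norm_mulVec (amplify_mem_unitaryGroup p (hQs i hi') (hQs _ hi) _), ih hi']

/-- With enough levels of amplification and enough qubits for the phase estimation, the sample is
prepared with any given precision. -/
theorem exists_tv_preparedSample_le {r : ℕ} {Qs : ℕ → Matrix Ω Ω ℝ} {π : ℕ → Ω → ℝ}
    (hQs : ∀ i ≤ r, Qs i ∈ Matrix.rowStochastic ℝ Ω) (herg : ∀ i ≤ r, (Qs i).IsPrimitive)
    (hπ : ∀ i ≤ r, IsStationary (Qs i) (π i)) (hrev : ∀ i ≤ r, IsReversible (Qs i) (π i))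
    (hov : ∀ i < r, overlap (π i) (π (i + 1)) ≠ 0) {η : ℝ} (hη : 0 < η) :
    ∃ p : Params, tv (preparedSample p Qs (π 0) r) (π r) ≤ η := by
  obtain ⟨z, hz, hlim⟩ := exists_tendsto_idealState (u := fun i => sqrtVec (π i)) (r := r)
    (fun i hi => sqrtVec_dotProduct_self (hπ i hi).1)
    (fun i hi => by
      rw [sqrtVec_dotProduct_sqrtVec, Complex.norm_real]
      exact norm_pos_iff.2 (hov i hi)) r le_rfl
  -- The order matters: `m` is fixed first, since the convergence in `t` is for a fixed circuit
  -- depth. Two errors of `η / 4`, doubled by `tv_measure_le`, make `η`.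
  obtain ⟨m, hm⟩ := (hlim.eventually_lt_const (show 0 < η / 4 by linarith)).exists
  obtain ⟨t, ht⟩ := ((tendsto_preparedState hQs herg hπ hrev m r le_rfl).eventually_lt_const
    (show 0 < η / 4 by linarith)).exists
  refine ⟨⟨t, 1, m⟩, (tv_measure_le ⟨t, 1, m⟩ (hπ r le_rfl).1
    (l2norm_preparedState _ hQs (hπ 0 r.zero_le).1 r le_rfl) (hz m)).trans ?_⟩
  have h := l2norm_sub_le_add (preparedState ⟨t, 1, m⟩ Qs (π 0) r)
    (emb ⟨t, 1, m⟩ (idealState m (fun j => sqrtVec (π j)) r))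
    (z m • emb ⟨t, 1, m⟩ (sqrtVec (π r)))
  rw [← emb_smul, ← emb_sub, l2norm_emb] at h
  rw [← emb_smul]
  linarith

end Sample

end QSample

theorem corollary3 {Ω : Type*} [Fintype Ω] [DecidableEq Ω]
    -- the original chain `P` with stationary distribution `πP`, and its perturbation `Q = P + E`
    (P Q E : Matrix Ω Ω ℝ) (hP : P ∈ Matrix.rowStochastic ℝ Ω) (hQ : Q = P + E)
    (πP : Ω → ℝ) (hπP : QSample.IsStationary P πP) (hτ : QSample.tau₁ P < 1)
    -- the sequence of ergodic reversible chains `Q₀, …, Q_r = Q` with stationary distributions `πᵢ`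
    (r : ℕ) (Qs : ℕ → Matrix Ω Ω ℝ) (π : ℕ → Ω → ℝ) (hr : Qs r = Q)
    (hQs : ∀ i ≤ r, Qs i ∈ Matrix.rowStochastic ℝ Ω) (herg : ∀ i ≤ r, (Qs i).IsPrimitive)
    (hπ : ∀ i ≤ r, QSample.IsStationary (Qs i) (π i))
    (hrev : ∀ i ≤ r, QSample.IsReversible (Qs i) (π i))
    (c : ℝ) (hc : 0 < c) (hov : ∀ i < r, c ≤ |QSample.overlap (π i) (π (i + 1))| ^ 2)
    (η : ℝ) (hη : 0 < η) :
    -- the method can be run with precision `η`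
    (∃ p : QSample.Params, QSample.tv (QSample.preparedSample p Qs (π 0) r) (π r) ≤ η) ∧
    -- and whenever it is, the prepared sample is close to the true stationary distribution
    (∀ p : QSample.Params, QSample.tv (QSample.preparedSample p Qs (π 0) r) (π r) ≤ η →
      QSample.tv (QSample.preparedSample p Qs (π 0) r) πP ≤
        η + QSample.infNorm E / (2 * (1 - QSample.tau₁ P))) := by
  subst hQ
  refine ⟨QSample.exists_tv_preparedSample_le hQs herg hπ hrev (fun i hi h0 => ?_) hη,
    fun p hp => ?_⟩
  · have := hov i hi
    rw [h0, abs_zero, zero_pow two_ne_zero] at this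
    linarith
  · have hstat := hπ r le_rfl
    rw [hr] at hstat
    exact (QSample.tv_triangle _ (π r) _).trans
      (add_le_add hp (QSample.tv_stationary_le hP hτ hπP hstat))
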